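/- Let $\mathfrak g$ be a finite-dimensional semisimple complex Lie algebra, with a Cartan subalgebra $\mathfrak h$, simple coroots $h_1,\dots,h_r\in\mathfrak h$ for a choice of simple roots, and $\mathfrak n_+$ the sum of the positive root spaces. Let $M$ be a complex affine variety with algebra of functions $A$. For a dominant integral weight $\lambda$ put $\lambda_i=\lambda(h_i)\in\mathbb Z_{\ge 0}$. A $\lambda$-multiset is a family $\{\mathcal Z\}_\lambda=(\mathcal Z^{(i)}_j)_{1\le i\le r,\,1\le j\le\lambda_i}$ of not necessarily distinct points of $M$. The local Weyl module $W_M(\{\mathcal Z\}_\lambda)$ is the maximal $\mathfrak g\otimes A$-module (every other one is a quotient of it) that is generated by a vector $v$ with $$(x\otimes P)\,v=0,\qquad (h_i\otimes P)\,v=\Big(\sum_{j=1}^{\lambda_i}P\big(\mathcal Z^{(i)}_j\big)\Big)v\qquad(x\in\mathfrak n_+,\ 1\le i\le r,\ P\in A)$$ and is integrable over $\mathfrak g\otimes 1$, i.e. is the direct sum of its $\mathfrak h\otimes 1$-weight spaces $V^\mu$ for finitely many $\mu$ in the weight lattice. Suppose that $M$ is non-singular of dimension $d$, that is, the local ring of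 $M$ at every point is a regular local ring of dimension $d$. Then for every dominant integral weight $\lambda$ and every $\lambda$-multiset $\{\mathcal Z\}_\lambda$ of points of $M$ there are dominant integral weights $\lambda^1,\dots,\lambda^s$ and an isomorphism of complex vector spaces $$W_M(\{\mathcal Z\}_\lambda)\;\cong\;\bigotimes_{i=1}^{s}W_{\mathbb C^d}(\{0\}_{\lambda^i}),$$ where $\{0\}_{\lambda^i}$ is the $\lambda^i$-multiset on $\mathbb C^d$ all of whose points are the origin. -/

import Mathlib

open scoped TensorProduct

noncomputable section

namespace WeylModule

open LieAlgebra LieAlgebra.IsKilling Module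

section Currents

variable (A g : Type*) [CommRing A] [Algebra ℂ A] [LieRing g] [LieAlgebra ℂ g]

/-- The enveloping algebra `U(g ⊗ A)` of the complex Lie algebra `g ⊗ A`, whose bracket is
`[x ⊗ P, y ⊗ Q] = [x, y] ⊗ P Q` (Mathlib writes the factor `A` on the left). -/
abbrev CurrentEnv : Type _ := UniversalEnvelopingAlgebra ℂ (A ⊗[ℂ] g)

variable {A g}

/-- The element `x ⊗ P` of `g ⊗ A`, regarded as an element of `U(g ⊗ A)`. -/
def current (x : g) (P : A) : CurrentEnv A g :=
  UniversalEnvelopingAlgebra.ι ℂ (P ⊗ₜ[ℂ] x)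

end Currents

section Weights

variable {g : Type*} [LieRing g] [LieAlgebra ℂ g] [FiniteDimensional ℂ g] [IsSemisimple ℂ g]
variable (H : LieSubalgebra ℂ g) [H.IsCartanSubalgebra]

/-- The weight lattice `P` in the dual of the Cartan subalgebra: the functionals that take
integer values on all coroots. -/
def weightLattice : Set (Dual ℂ H) :=
  {μ | ∀ α : H.root, ∃ n : ℤ, μ ((rootSystem H).coroot α) = n}

variable (A : Type*) [CommRing A] [Algebra ℂ A]
variable (V : Type*) [AddCommGroup V] [Module ℂ V] [Module (CurrentEnv A g) V]
  [IsScalarTower ℂ (CurrentEnv A g) V]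

/-- The weight space `V^μ` of a `g ⊗ A`-module `V`, with respect to the subalgebra `g ⊗ 1`: the
vectors on which every `h ⊗ 1`, `h` in the Cartan subalgebra, acts by the scalar `μ h`. -/
def weightSubspace (μ : Dual ℂ H) : Submodule ℂ V where
  carrier := {v | ∀ h : H, current (h : g) (1 : A) • v = μ h • v}
  zero_mem' h := by simp
  add_mem' hv hw h := by rw [smul_add, smul_add, hv h, hw h]
  smul_mem' c v hv h := by
    rw [smul_algebra_smul_comm, hv h, smul_comm]

/-- A `g ⊗ A`-module is `g ⊗ 1`-integrable if it is the direct sum of its weight spaces for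
finitely many weights in the weight lattice. (The sum of weight spaces for distinct weights is
always direct, so it is enough that they span.) -/
def IsIntegrable : Prop :=
  ∃ D : Finset (Dual ℂ H), (D : Set (Dual ℂ H)) ⊆ weightLattice H ∧
    ⨆ μ ∈ D, weightSubspace H A V μ = ⊤

end Weights

section Local

variable {g : Type*} [LieRing g] [LieAlgebra ℂ g] [FiniteDimensional ℂ g] [IsSemisimple ℂ g]
variable {H : LieSubalgebra ℂ g} [H.IsCartanSubalgebra] (b : (rootSystem H).Base)

/-- The nilpotent radical of the Borel subalgebra that contains the Cartan subalgebra `H` and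
corresponds to the base `b` of simple roots: the sum of the root spaces of all positive roots. -/
def nPlus : Submodule ℂ g :=
  ⨆ (α : H.root) (_ : b.IsPos α), (rootSpace H (α : LieModule.Weight ℂ H g)).toSubmodule

/-- A dominant integral weight `λ`, given by its coordinates `λ_i = λ (h_i)`, where `h_i` are the
simple coroots (they form a basis of the Cartan subalgebra). -/
abbrev DominantWeight : Type _ := b.support → ℕ

variable (A : Type*) [CommRing A] [Algebra ℂ A]

variable {b} in
/-- A `λ`-multiset of points of the affine variety with coordinate algebra `A`. The points of the
variety are the `ℂ`-algebra homomorphisms `A → ℂ`, such a homomorphism `z` being evaluation of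
functions at the point. -/
abbrev PointFamily (lam : DominantWeight b) : Type _ :=
  (i : b.support) → Fin (lam i) → (A →ₐ[ℂ] ℂ)

variable {A} {lam : DominantWeight b}

/-- Every `g ⊗ A`-module with a generator `v` is of the form `U(g ⊗ A) ⧸ I` with `v` the class of
`1` and `I` the annihilator of `v`. This predicate says that the module is `g ⊗ 1`-integrable and
that its generator `v` satisfies `(x ⊗ P) v = 0` for `x` in `n_+` and
`(h_i ⊗ P) v = (∑_j P (Z i j)) v`, for all `P` in `A`. -/
structure IsLocalWeylQuotient (Z : PointFamily A lam)
    (I : Submodule (CurrentEnv A g) (CurrentEnv A g)) : Prop where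
  nPlus_smul : ∀ x ∈ nPlus b, ∀ P : A,
    current x P • (Submodule.Quotient.mk 1 : CurrentEnv A g ⧸ I) = 0
  coroot_smul : ∀ (i : b.support) (P : A),
    current (((rootSystem H).coroot i : H) : g) P •
        (Submodule.Quotient.mk 1 : CurrentEnv A g ⧸ I) =
      (∑ j : Fin (lam i), Z i j P) • (Submodule.Quotient.mk 1 : CurrentEnv A g ⧸ I)
  integrable : IsIntegrable H A (CurrentEnv A g ⧸ I)

/-- The smallest left ideal of `U(g ⊗ A)` defining a module as in `IsLocalWeylQuotient`. -/
def localWeylIdeal (Z : PointFamily A lam) : Submodule (CurrentEnv A g) (CurrentEnv A g) :=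
  sInf {I | IsLocalWeylQuotient b Z I}

/-- The local Weyl module `W_M(Z)`, `A` being the algebra of functions on `M`: the maximal
`g ⊗ 1`-integrable `g ⊗ A`-module with a generator satisfying the relations above; that is, all
others are quotients of it. -/
abbrev LocalWeylModule (Z : PointFamily A lam) : Type _ :=
  CurrentEnv A g ⧸ localWeylIdeal b Z

/-- The point `0` of `ℂ^d`, as evaluation of polynomials at the origin. -/
def originPoint (d : ℕ) : MvPolynomial (Fin d) ℂ →ₐ[ℂ] ℂ := MvPolynomial.aeval 0

/-- The module `W_{ℂ^d}({0}_λ)`: the local Weyl module over `ℂ^d` for the `λ`-multiset all of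
whose points are the origin. -/
abbrev OriginWeylModule (d : ℕ) (lam : DominantWeight b) : Type _ :=
  LocalWeylModule b (A := MvPolynomial (Fin d) ℂ) (lam := lam) (fun _ _ => originPoint d)

end Local

/-- The affine variety with coordinate algebra `A` is non-singular of dimension `d`: the local
ring at each of its points is a regular local ring of Krull dimension `d`. -/
def IsNonsingularOfDim (A : Type*) [CommRing A] (d : ℕ) : Prop :=
  ∀ (m : Ideal A) [m.IsMaximal],
    IsRegularLocalRing (Localization.AtPrime m) ∧ ringKrullDim (Localization.AtPrime m) = d

end WeylModule

end

/-! Let v generate a module as in the definition of the local Weyl module, and let J be the ideal of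
functions vanishing at all the given points. Such a module only sees a neighbourhood of finite order
of these points. For a positive root with sl2-triple (h, e, f), integrability gives (f ⊗ 1)^(n+1) v
= 0. Applying (e ⊗ P)^n with P in J leaves a nonzero multiple of (f ⊗ P^n) v, which therefore
vanishes (`lowering_pow_apply_eq_zero`). As A is noetherian, some g ⊗ J^N kills v and hence the
whole module, with N independent of the module (`exists_pow_annihilates`), so A may be replaced by
A/J^N.

Two facts about these quotients finish the proof. Powers of coprime ideals split off as direct
factors, and U(g ⊗ (A₁ × A₂)) = U(g ⊗ A₁) ⊗ U(g ⊗ A₂) makes the Weyl module a tensor product over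
the distinct points (`nonempty_weylQuotient_prod_equiv`, `nonempty_weylQuotient_add_equiv`). At a
single non-singular point, A/p^N is the truncated polynomial ring in d variables, just as at the
origin of ℂ^d (`nonempty_pointWeyl_equiv`), because regular parameters satisfy no homogeneous
relation (`eq_zero_of_aeval_mem_pow_succ`).

Points are replaced throughout by the functionals χ i through which h_i ⊗ P acts on v. The local
Weyl ideal is an infimum that is never shown to define an integrable module itself, so the arguments
run over all the ideals entering the infimum. -/

noncomputable section

namespace WeylModule

open LieAlgebra LieAlgebra.IsKilling Module

/-! ### Enveloping algebras of current algebras. -/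

section Enveloping

attribute [local instance 100] LieRing.ofAssociativeRing

variable {A g : Type*} [CommRing A] [Algebra ℂ A] [LieRing g] [LieAlgebra ℂ g]

lemma current_add_left (x y : g) (P : A) : current (x + y) P = current x P + current y P := by
  simp only [current, TensorProduct.tmul_add, map_add]

lemma current_smul_left (c : ℂ) (x : g) (P : A) : current (c • x) P = c • current x P := by
  simp only [current, TensorProduct.tmul_smul, map_smul]

lemma current_add_right (x : g) (P Q : A) : current x (P + Q) = current x P + current x Q := by
  simp only [current, TensorProduct.add_tmul, map_add]

lemma current_zero_left (P : A) : current (0 : g) P = 0 := by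
  simp only [current, TensorProduct.tmul_zero, map_zero]

lemma current_zero_right (x : g) : current x (0 : A) = 0 := by
  simp only [current, TensorProduct.zero_tmul, map_zero]

lemma current_mul_sub_mul (x y : g) (P Q : A) :
    current x P * current y Q - current y Q * current x P = current ⁅x, y⁆ (P * Q) := by
  simp only [current, ← ExtendScalars.bracket_tmul, LieHom.map_lie,
    LieRing.of_associative_ring_bracket]

variable (A g) in
/-- The inclusion of `A ⊗ g` in its enveloping algebra, as a linear map. -/
def currentLin : A ⊗[ℂ] g →ₗ[ℂ] CurrentEnv A g :=
  (UniversalEnvelopingAlgebra.ι ℂ : A ⊗[ℂ] g →ₗ⁅ℂ⁆ CurrentEnv A g).toLinearMap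

lemma currentLin_tmul (x : g) (P : A) : currentLin A g (P ⊗ₜ x) = current x P := rfl

/-- A linear map on `A ⊗ g` that respects brackets extends to the enveloping algebra. -/
def liftCurrent {R : Type*} [Ring R] [Algebra ℂ R] (φ : A ⊗[ℂ] g →ₗ[ℂ] R)
    (hφ : ∀ (x y : g) (P Q : A), φ (P ⊗ₜ x) * φ (Q ⊗ₜ y) - φ (Q ⊗ₜ y) * φ (P ⊗ₜ x) =
      φ ((P * Q) ⊗ₜ ⁅x, y⁆)) : CurrentEnv A g →ₐ[ℂ] R :=
  UniversalEnvelopingAlgebra.lift ℂ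
    { φ with
      map_lie' := by
        intro a c
        change φ ⁅a, c⁆ = φ a * φ c - φ c * φ a
        induction a using TensorProduct.induction_on with
        | zero => simp
        | add a a' ha ha' => rw [add_lie, map_add, ha, ha', map_add]; noncomm_ring
        | tmul P x =>
          induction c using TensorProduct.induction_on with
          | zero => simp
          | add c c' hc hc' => rw [lie_add, map_add, hc, hc', map_add]; noncomm_ring
          | tmul Q y => rw [ExtendScalars.bracket_tmul, hφ] }

@[simp]
lemma liftCurrent_current {R : Type*} [Ring R] [Algebra ℂ R] (φ : A ⊗[ℂ] g →ₗ[ℂ] R)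
    (hφ : ∀ (x y : g) (P Q : A), φ (P ⊗ₜ x) * φ (Q ⊗ₜ y) - φ (Q ⊗ₜ y) * φ (P ⊗ₜ x) =
      φ ((P * Q) ⊗ₜ ⁅x, y⁆)) (x : g) (P : A) :
    liftCurrent φ hφ (current x P) = φ (P ⊗ₜ x) :=
  UniversalEnvelopingAlgebra.lift_ι_apply _ _ _

lemma currentEnv_algHom_ext {R : Type*} [Ring R] [Algebra ℂ R] {F G : CurrentEnv A g →ₐ[ℂ] R}
    (h : ∀ (x : g) (P : A), F (current x P) = G (current x P)) : F = G := by
  apply UniversalEnvelopingAlgebra.hom_ext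
  ext a
  change F (UniversalEnvelopingAlgebra.ι ℂ a) = G (UniversalEnvelopingAlgebra.ι ℂ a)
  induction a using TensorProduct.induction_on with
  | zero => simp only [map_zero]
  | add a a' ha ha' => simp only [map_add, ha, ha']
  | tmul P x => exact h x P

/-- The universal property gives a map from the enveloping algebra to `S`; followed by the inclusion
it is the identity on generators, hence everywhere. This serves as the induction principle for the
enveloping algebra. -/
lemma subalgebra_eq_top_of_current_mem (S : Subalgebra ℂ (CurrentEnv A g))
    (h : ∀ (x : g) (P : A), current x P ∈ S) : S = ⊤ := by
  have hι : ∀ a : A ⊗[ℂ] g, currentLin A g a ∈ Subalgebra.toSubmodule S := by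
    intro a
    induction a using TensorProduct.induction_on with
    | zero => simp only [map_zero, zero_mem]
    | add a a' ha ha' => simpa only [map_add] using add_mem ha ha'
    | tmul P x => exact h x P
  let φ : A ⊗[ℂ] g →ₗ[ℂ] S :=
    (currentLin A g).codRestrict
      (Subalgebra.toSubmodule S) hι
  have hF : S.val.comp (liftCurrent φ (fun x y P Q => Subtype.ext
      (current_mul_sub_mul x y P Q))) = AlgHom.id ℂ _ := by
    apply currentEnv_algHom_ext
    intro x P
    rw [AlgHom.comp_apply, liftCurrent_current]
    rfl
  rw [eq_top_iff]
  intro u _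
  have := DFunLike.congr_fun hF u
  rw [AlgHom.id_apply] at this
  rw [← this]
  exact Subtype.property _

/-- The map of enveloping algebras that is induced by a homomorphism of algebras, which need not
respect the unit. -/
def currentMap {A' : Type*} [CommRing A'] [Algebra ℂ A'] (f : A →ₙₐ[ℂ] A') :
    CurrentEnv A g →ₐ[ℂ] CurrentEnv A' g :=
  liftCurrent (currentLin A' g ∘ₗ (f : A →ₗ[ℂ] A').rTensor g) (fun x y P Q => by
      have := current_mul_sub_mul x y (f P) (f Q)
      rw [← map_mul] at this
      exact this)

@[simp]
lemma currentMap_current {A' : Type*} [CommRing A'] [Algebra ℂ A'] (f : A →ₙₐ[ℂ] A') (x : g)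
    (P : A) : currentMap f (current x P) = current x (f P) :=
  liftCurrent_current _ _ _ _

end Enveloping

/-! ### Weyl vectors in representations and the local Weyl ideal. -/

section WeylVector

variable {A g : Type*} [CommRing A] [Algebra ℂ A] [LieRing g] [LieAlgebra ℂ g]
variable {V : Type*} [AddCommGroup V] [Module ℂ V]

/-- The annihilator of a vector in a representation of the enveloping algebra. -/
def annIdeal (ρ : CurrentEnv A g →ₐ[ℂ] End ℂ V) (v : V) :
    Submodule (CurrentEnv A g) (CurrentEnv A g) where
  carrier := {u | ρ u v = 0}
  zero_mem' := by simp
  add_mem' {u w} hu hw := by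
    simp only [Set.mem_ofPred_eq] at hu hw ⊢
    rw [map_add, LinearMap.add_apply, hu, hw, add_zero]
  smul_mem' c u hu := by
    simp only [Set.mem_ofPred_eq] at hu ⊢
    rw [smul_eq_mul, map_mul, Module.End.mul_apply, hu, map_zero]

lemma mem_annIdeal {ρ : CurrentEnv A g →ₐ[ℂ] End ℂ V} {v : V} {u : CurrentEnv A g} :
    u ∈ annIdeal ρ v ↔ ρ u v = 0 := Iff.rfl

/-- The weight spaces of a representation of the enveloping algebra of `g ⊗ A` on `V`. -/
def repWeightSpace (H : LieSubalgebra ℂ g) (ρ : CurrentEnv A g →ₐ[ℂ] End ℂ V)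
    (μ : Dual ℂ H) : Submodule ℂ V :=
  ⨅ h : H, LinearMap.ker (ρ (current (h : g) 1) - algebraMap ℂ (End ℂ V) (μ h))

lemma mem_repWeightSpace {H : LieSubalgebra ℂ g} {ρ : CurrentEnv A g →ₐ[ℂ] End ℂ V}
    {μ : Dual ℂ H} {v : V} :
    v ∈ repWeightSpace H ρ μ ↔ ∀ h : H, ρ (current (h : g) 1) v = μ h • v := by
  simp [repWeightSpace, sub_eq_zero]

/-- Every element of a finite sum of simultaneous eigenspaces that lies in a stable subspace has
its components in this subspace. -/
lemma mem_of_sum_mem_of_stable {𝔥 : Type*} [AddCommGroup 𝔥] [Module ℂ 𝔥] (T : 𝔥 → End ℂ V)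
    (p : Submodule ℂ V) (hp : ∀ h, ∀ w ∈ p, T h w ∈ p) (D : Finset (Dual ℂ 𝔥))
    (w : Dual ℂ 𝔥 → V) (hw : ∀ μ ∈ D, ∀ h, T h (w μ) = μ h • w μ)
    (hsum : ∑ μ ∈ D, w μ ∈ p) : ∀ μ ∈ D, w μ ∈ p := by
  classical
  intro μ hμ
  -- `F` is a product of operators `T h - ν h`, one for each `ν` in `E`, with `h` chosen so that `μ
  -- h ≠ ν h`. For `E = D \ {μ}` it isolates the component `w μ` up to a nonzero scalar.
  suffices H : ∀ E : Finset (Dual ℂ 𝔥), μ ∉ E → ∃ F : End ℂ V, ∃ c : Dual ℂ 𝔥 → ℂ,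
      (∀ w ∈ p, F w ∈ p) ∧ (∀ ν ∈ D, F (w ν) = c ν • w ν) ∧ c μ ≠ 0 ∧ ∀ ν ∈ E, c ν = 0 by
    obtain ⟨F, c, hF, hFc, hcμ, hc⟩ := H (D.erase μ) (D.notMem_erase μ)
    have h1 := hF _ hsum
    rw [map_sum, Finset.sum_congr rfl hFc, ← Finset.add_sum_erase _ _ hμ,
      Finset.sum_eq_zero (fun ν hν => by rw [hc ν hν, zero_smul]), add_zero] at h1
    exact (Submodule.smul_mem_iff _ hcμ).mp h1
  intro E
  induction E using Finset.induction_on with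
  | empty => exact fun _ => ⟨1, fun _ => 1, by simp⟩
  | insert ν E hν ih =>
    intro hμE
    rw [Finset.mem_insert, not_or] at hμE
    obtain ⟨F, c, hF, hFc, hcμ, hc⟩ := ih hμE.2
    obtain ⟨h, hh⟩ : ∃ h, μ h ≠ ν h := by
      by_contra! hcon
      exact hμE.1 (LinearMap.ext hcon)
    refine ⟨(T h - algebraMap ℂ _ (ν h)) * F, fun κ => (κ h - ν h) * c κ, ?_, ?_, ?_, ?_⟩
    · intro w' hw'
      simp only [Module.End.mul_apply, LinearMap.sub_apply, Module.algebraMap_end_apply]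
      exact sub_mem (hp h _ (hF _ hw')) (p.smul_mem _ (hF _ hw'))
    · intro κ hκ
      simp only [Module.End.mul_apply, LinearMap.sub_apply, Module.algebraMap_end_apply,
        hFc κ hκ, map_smul, hw κ hκ h]
      module
    · exact mul_ne_zero (sub_ne_zero.mpr hh) hcμ
    · intro κ hκ
      rcases Finset.mem_insert.mp hκ with rfl | hκ
      · simp
      · simp [hc κ hκ]

lemma mem_biSup_iff_exists_sum {ι : Type*} (D : Finset ι) (p : ι → Submodule ℂ V) (v : V) :
    v ∈ ⨆ i ∈ D, p i ↔ ∃ w : ι → V, (∀ i ∈ D, w i ∈ p i) ∧ ∑ i ∈ D, w i = v := by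
  classical
  rw [Submodule.mem_iSup_finset_iff_exists_sum]
  constructor
  · rintro ⟨w, hw⟩
    exact ⟨fun i => w i, fun i _ => (w i).2, hw⟩
  · rintro ⟨w, hw, rfl⟩
    refine ⟨fun i => if h : i ∈ D then ⟨w i, hw i h⟩ else 0, Finset.sum_congr rfl fun i hi => ?_⟩
    simp [hi]

/-- The representation of the enveloping algebra on its quotient by a left ideal. -/
abbrev quotRep (I : Submodule (CurrentEnv A g) (CurrentEnv A g)) :
    CurrentEnv A g →ₐ[ℂ] End ℂ (CurrentEnv A g ⧸ I) :=
  Algebra.lsmul ℂ ℂ (CurrentEnv A g ⧸ I)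

lemma quotRep_mk (I : Submodule (CurrentEnv A g) (CurrentEnv A g)) (u w : CurrentEnv A g) :
    quotRep I u (Submodule.Quotient.mk w) =
      Submodule.Quotient.mk (u * w) := rfl

lemma quotRep_mk_one (I : Submodule (CurrentEnv A g) (CurrentEnv A g)) (u : CurrentEnv A g) :
    quotRep I u (Submodule.Quotient.mk 1) =
      Submodule.Quotient.mk u := by
  rw [quotRep_mk, mul_one]

variable [FiniteDimensional ℂ g] [IsSemisimple ℂ g]
variable {H : LieSubalgebra ℂ g} [H.IsCartanSubalgebra] (b : (rootSystem H).Base)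

/-- The vector `v` satisfies the relations of the local Weyl module with `h_i ⊗ P` acting by
`χ i P`, and the submodule generated by `v` is integrable. -/
structure IsWeylVector (χ : b.support → A →ₗ[ℂ] ℂ) (ρ : CurrentEnv A g →ₐ[ℂ] End ℂ V) (v : V) :
    Prop where
  nPlus_apply : ∀ x ∈ nPlus b, ∀ P : A, ρ (current x P) v = 0
  coroot_apply : ∀ (i : b.support) (P : A),
    ρ (current (((rootSystem H).coroot i : H) : g) P) v = χ i P • v
  integrable : ∃ D : Finset (Dual ℂ H), (D : Set (Dual ℂ H)) ⊆ weightLattice H ∧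
    ∀ u, ρ u v ∈ ⨆ μ ∈ D, repWeightSpace H ρ μ

/-- The left ideals `I` for which the generator of `U(g ⊗ A) ⧸ I` is a Weyl vector. -/
def IsWeylQuotient (χ : b.support → A →ₗ[ℂ] ℂ)
    (I : Submodule (CurrentEnv A g) (CurrentEnv A g)) : Prop :=
  IsWeylVector b χ (quotRep I) (Submodule.Quotient.mk 1)

/-- The local Weyl ideal attached to the functionals `χ`. -/
def weylIdeal (χ : b.support → A →ₗ[ℂ] ℂ) : Submodule (CurrentEnv A g) (CurrentEnv A g) :=
  sInf {I | IsWeylQuotient b χ I}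

variable {b}

lemma mem_weylIdeal {χ : b.support → A →ₗ[ℂ] ℂ} {u : CurrentEnv A g} :
    u ∈ weylIdeal b χ ↔ ∀ I, IsWeylQuotient b χ I → u ∈ I := by
  simp [weylIdeal, Submodule.mem_sInf]

/-- The quotient by the annihilator is the submodule generated by `v`. For integrability, the weight
components of `ρ u v` must lie in this submodule, not merely in `V`; they do because it is stable
under the Cartan subalgebra. -/
lemma IsWeylVector.isWeylQuotient {χ : b.support → A →ₗ[ℂ] ℂ}
    {ρ : CurrentEnv A g →ₐ[ℂ] End ℂ V} {v : V} (hv : IsWeylVector b χ ρ v) :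
    IsWeylQuotient b χ (annIdeal ρ v) := by
  refine ⟨fun x hx P => ?_, fun i P => ?_, ?_⟩
  · rw [quotRep_mk_one, Submodule.Quotient.mk_eq_zero, mem_annIdeal]
    exact hv.nPlus_apply x hx P
  · rw [quotRep_mk_one, ← Submodule.Quotient.mk_smul, Submodule.Quotient.eq, mem_annIdeal, map_sub,
      LinearMap.sub_apply, hv.coroot_apply, map_smul, map_one]
    simp
  · obtain ⟨D, hD, hDv⟩ := hv.integrable
    refine ⟨D, hD, fun u => ?_⟩
    obtain ⟨w, hw, hsum⟩ := (mem_biSup_iff_exists_sum _ _ _).mp (hDv u)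
    let ev : CurrentEnv A g →ₗ[ℂ] V := (LinearMap.applyₗ v) ∘ₗ ρ.toLinearMap
    have hmem := mem_of_sum_mem_of_stable (fun h : H => ρ (current (h : g) 1)) (LinearMap.range ev)
      (by
        rintro h _ ⟨u, rfl⟩
        exact ⟨current (h : g) 1 * u, by simp [ev]⟩) D w
      (fun μ hμ h => mem_repWeightSpace.mp (hw μ hμ) h) (by rw [hsum]; exact ⟨u, rfl⟩)
    choose! y hy using hmem
    rw [mem_biSup_iff_exists_sum]
    refine ⟨fun μ => Submodule.Quotient.mk (y μ), fun μ hμ => ?_, ?_⟩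
    · rw [mem_repWeightSpace]
      intro h
      rw [quotRep_mk, ← Submodule.Quotient.mk_smul,
        Submodule.Quotient.eq, mem_annIdeal, map_sub, map_mul, map_smul,
        LinearMap.sub_apply, Module.End.mul_apply, LinearMap.smul_apply]
      have h1 : ρ (y μ) v = w μ := hy μ hμ
      rw [h1, mem_repWeightSpace.mp (hw μ hμ) h, sub_self]
    · rw [quotRep_mk_one]
      have : ∑ μ ∈ D, (Submodule.Quotient.mk (y μ) : CurrentEnv A g ⧸ annIdeal ρ v) =
          Submodule.Quotient.mk (∑ μ ∈ D, y μ) := by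
        rw [← Submodule.mkQ_apply, map_sum]; rfl
      rw [this, Submodule.Quotient.eq, mem_annIdeal, map_sub, LinearMap.sub_apply, map_sum,
        LinearMap.sum_apply, sub_eq_zero, ← hsum]
      exact Finset.sum_congr rfl fun μ hμ => hy μ hμ

/-- Maximality of the local Weyl module, in the form used below: it maps onto the submodule
generated by any Weyl vector. -/
lemma IsWeylVector.apply_eq_zero {χ : b.support → A →ₗ[ℂ] ℂ}
    {ρ : CurrentEnv A g →ₐ[ℂ] End ℂ V} {v : V} (hv : IsWeylVector b χ ρ v) {u : CurrentEnv A g}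
    (hu : u ∈ weylIdeal b χ) : ρ u v = 0 :=
  mem_weylIdeal.mp hu _ hv.isWeylQuotient

/-- The functionals by which the `h_i ⊗ P` act on the generator of a local Weyl module. -/
def familyChar {lam : DominantWeight b} (Z : PointFamily A lam) (i : b.support) : A →ₗ[ℂ] ℂ :=
  ∑ j : Fin (lam i), (Z i j).toLinearMap

lemma isLocalWeylQuotient_iff {lam : DominantWeight b} (Z : PointFamily A lam)
    (I : Submodule (CurrentEnv A g) (CurrentEnv A g)) :
    IsLocalWeylQuotient b Z I ↔ IsWeylQuotient b (familyChar Z) I := by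
  have key : IsIntegrable H A (CurrentEnv A g ⧸ I) ↔
      ∃ D : Finset (Dual ℂ H), (D : Set (Dual ℂ H)) ⊆ weightLattice H ∧
        ∀ u : CurrentEnv A g, quotRep I u (Submodule.Quotient.mk 1) ∈
          ⨆ μ ∈ D, repWeightSpace H (quotRep I) μ := by
    have hW : ∀ μ : Dual ℂ H, repWeightSpace H (quotRep I) μ =
        weightSubspace H A (CurrentEnv A g ⧸ I) μ := by
      intro μ
      ext v
      rw [mem_repWeightSpace]
      rfl
    simp only [IsIntegrable, hW, quotRep_mk_one]
    refine exists_congr fun D => and_congr_right fun _ => ?_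
    rw [Submodule.eq_top_iff']
    exact (Submodule.Quotient.mk_surjective I).forall
  constructor
  · rintro ⟨h1, h2, h3⟩
    exact ⟨h1, fun i P => by simpa [familyChar] using h2 i P, key.mp h3⟩
  · rintro ⟨h1, h2, h3⟩
    exact ⟨h1, fun i P => by simpa [familyChar] using h2 i P, key.mpr h3⟩

/-- Unlike families of points, functionals can be added and transported along algebra maps. -/
lemma localWeylIdeal_eq {lam : DominantWeight b} (Z : PointFamily A lam) :
    localWeylIdeal b Z = weylIdeal b (familyChar Z) := by
  simp only [localWeylIdeal, weylIdeal, isLocalWeylQuotient_iff]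

end WeylVector

/-- A surjective `ℂ`-linear map with kernel a left ideal identifies the quotient. -/
lemma nonempty_quotient_equiv_of_surjective {U V : Type*} [Ring U] [Algebra ℂ U] [AddCommGroup V]
    [Module ℂ V] (I : Submodule U U) (ψ : U →ₗ[ℂ] V) (hψ : Function.Surjective ψ)
    (hI : ∀ u, ψ u = 0 ↔ u ∈ I) : Nonempty ((U ⧸ I) ≃ₗ[ℂ] V) := by
  have hker : LinearMap.ker ψ = I.restrictScalars ℂ := by
    ext u
    exact hI u
  exact ⟨(Submodule.Quotient.restrictScalarsEquiv ℂ I).symm ≪≫ₗ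
    Submodule.quotEquivOfEq _ _ hker.symm ≪≫ₗ ψ.quotKerEquivOfSurjective hψ⟩

/-! ### Passage to a quotient algebra. -/

section Surjection

variable {A C g : Type*} [CommRing A] [Algebra ℂ A] [CommRing C] [Algebra ℂ C]
  [LieRing g] [LieAlgebra ℂ g]

lemma currentMap_surjective (f : A →ₙₐ[ℂ] C) (hf : Function.Surjective f) :
    Function.Surjective (currentMap f : CurrentEnv A g →ₐ[ℂ] CurrentEnv C g) := by
  rw [← AlgHom.range_eq_top]
  apply subalgebra_eq_top_of_current_mem
  intro x P
  obtain ⟨Q, rfl⟩ := hf P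
  exact ⟨current x Q, currentMap_current f x Q⟩

lemma comp_currentMap_current {R : Type*} [Ring R] [Algebra ℂ R] (π : A →ₐ[ℂ] C)
    (ρ : CurrentEnv C g →ₐ[ℂ] R) (x : g) (P : A) :
    (ρ.comp (currentMap (π : A →ₙₐ[ℂ] C))) (current x P) = ρ (current x (π P)) := by
  rw [AlgHom.comp_apply, currentMap_current]
  rfl

/-- A representation of `g ⊗ A` on which `g ⊗ ker π` acts by zero comes from `g ⊗ C`. -/
lemma exists_rep_comp_currentMap {R : Type*} [Ring R] [Algebra ℂ R] (π : A →ₐ[ℂ] C)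
    (hπ : Function.Surjective π) (ρ : CurrentEnv A g →ₐ[ℂ] R)
    (hρ : ∀ (x : g) (P : A), π P = 0 → ρ (current x P) = 0) :
    ∃ ρ' : CurrentEnv C g →ₐ[ℂ] R, ∀ u, ρ' (currentMap (π : A →ₙₐ[ℂ] C) u) = ρ u := by
  obtain ⟨s, hs⟩ := LinearMap.exists_rightInverse_of_surjective π.toLinearMap
    (LinearMap.range_eq_top.mpr hπ)
  have hs' : ∀ P, π (s P) = P := fun P => LinearMap.congr_fun hs P
  have hcongr : ∀ (x : g) (P Q : A), π P = π Q → ρ (current x P) = ρ (current x Q) := by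
    intro x P Q h
    have h1 := hρ x (P - Q) (by rw [map_sub, h, sub_self])
    have h2 := current_add_right x (P - Q) Q
    rw [sub_add_cancel] at h2
    rw [h2, map_add, h1, zero_add]
  -- The section `s` is only linear. Brackets are still respected, since `s (P * Q)` and `s P * s Q`
  -- have the same image under `π` and `ρ` does not distinguish them.
  let φ : C ⊗[ℂ] g →ₗ[ℂ] R := ρ.toLinearMap ∘ₗ currentLin A g ∘ₗ s.rTensor g
  have hφ : ∀ (x : g) (P : C), φ (P ⊗ₜ x) = ρ (current x (s P)) := fun x P => rfl
  refine ⟨liftCurrent φ fun x y P Q => ?_, ?_⟩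
  · rw [hφ, hφ, hφ, ← map_mul, ← map_mul, ← map_sub, current_mul_sub_mul]
    apply hcongr
    rw [map_mul, hs', hs', hs']
  · intro u
    have : (liftCurrent φ fun x y P Q => by
        rw [hφ, hφ, hφ, ← map_mul, ← map_mul, ← map_sub, current_mul_sub_mul]
        apply hcongr
        rw [map_mul, hs', hs', hs']).comp (currentMap (π : A →ₙₐ[ℂ] C)) = ρ := by
      apply currentEnv_algHom_ext
      intro x P
      rw [AlgHom.comp_apply, currentMap_current, liftCurrent_current, hφ]
      apply hcongr
      exact hs' _
    exact DFunLike.congr_fun this u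

variable [FiniteDimensional ℂ g] [IsSemisimple ℂ g]
variable {H : LieSubalgebra ℂ g} [H.IsCartanSubalgebra] {b : (rootSystem H).Base}
variable {V : Type*} [AddCommGroup V] [Module ℂ V]

lemma isWeylVector_comp_currentMap_iff (π : A →ₐ[ℂ] C) (hπ : Function.Surjective π)
    (χ : b.support → C →ₗ[ℂ] ℂ) (ρ : CurrentEnv C g →ₐ[ℂ] End ℂ V) (v : V) :
    IsWeylVector b (fun i => χ i ∘ₗ π.toLinearMap) (ρ.comp (currentMap (π : A →ₙₐ[ℂ] C))) v ↔
      IsWeylVector b χ ρ v := by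
  have hW : ∀ μ : Dual ℂ H, repWeightSpace H (ρ.comp (currentMap (π : A →ₙₐ[ℂ] C))) μ =
      repWeightSpace H ρ μ := by
    intro μ
    ext w
    simp only [mem_repWeightSpace, comp_currentMap_current, map_one]
  constructor
  · rintro ⟨h1, h2, D, hD, h3⟩
    refine ⟨fun x hx P => ?_, fun i P => ?_, D, hD, fun u => ?_⟩
    · obtain ⟨Q, rfl⟩ := hπ P
      rw [← comp_currentMap_current, h1 x hx Q]
    · obtain ⟨Q, rfl⟩ := hπ P
      rw [← comp_currentMap_current, h2 i Q]
      rfl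
    · obtain ⟨u, rfl⟩ := currentMap_surjective (π : A →ₙₐ[ℂ] C) hπ u
      rw [← AlgHom.comp_apply]
      simpa only [hW] using h3 u
  · rintro ⟨h1, h2, D, hD, h3⟩
    refine ⟨fun x hx P => ?_, fun i P => ?_, D, hD, fun u => ?_⟩
    · rw [comp_currentMap_current, h1 x hx]
    · rw [comp_currentMap_current, h2 i]
      rfl
    · rw [AlgHom.comp_apply]
      simpa only [hW] using h3 (currentMap (π : A →ₙₐ[ℂ] C) u)

/-- If `g ⊗ ker π` annihilates every module that satisfies the relations of the local Weyl module,
then the local Weyl modules over `A` and over its quotient `C` agree. -/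
theorem nonempty_weylQuotient_equiv_of_surjective (π : A →ₐ[ℂ] C) (hπ : Function.Surjective π)
    (χ : b.support → C →ₗ[ℂ] ℂ)
    (hkill : ∀ I, IsWeylQuotient b (fun i => χ i ∘ₗ π.toLinearMap) I →
      ∀ (x : g) (P : A), π P = 0 → quotRep I (current x P) = 0) :
    Nonempty ((CurrentEnv A g ⧸ weylIdeal b (fun i => χ i ∘ₗ π.toLinearMap)) ≃ₗ[ℂ]
      CurrentEnv C g ⧸ weylIdeal b χ) := by
  refine nonempty_quotient_equiv_of_surjective _
    (((weylIdeal b χ).mkQ.restrictScalars ℂ) ∘ₗ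
      (currentMap (π : A →ₙₐ[ℂ] C) : CurrentEnv A g →ₐ[ℂ] CurrentEnv C g).toLinearMap)
    ((Submodule.mkQ_surjective _).comp (currentMap_surjective _ hπ)) fun u => ?_
  change Submodule.Quotient.mk (currentMap (π : A →ₙₐ[ℂ] C) u) = 0 ↔ _
  rw [Submodule.Quotient.mk_eq_zero]
  constructor
  · rw [mem_weylIdeal (u := u)]
    intro hu I hI
    -- The quotient by `I` becomes a module over g ⊗ C whose generator is still a Weyl vector, so
    -- the Weyl ideal over `C` kills it.
    obtain ⟨ρ, hρ⟩ := exists_rep_comp_currentMap π hπ (quotRep I) (hkill I hI)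
    have hρ' : ρ.comp (currentMap (π : A →ₙₐ[ℂ] C)) = quotRep I := AlgHom.ext hρ
    rw [IsWeylQuotient, ← hρ', isWeylVector_comp_currentMap_iff π hπ] at hI
    have := hI.apply_eq_zero hu
    rwa [hρ, quotRep_mk_one, Submodule.Quotient.mk_eq_zero] at this
  · intro hu
    rw [mem_weylIdeal]
    intro J hJ
    have := ((isWeylVector_comp_currentMap_iff π hπ χ _ _).mpr hJ).apply_eq_zero hu
    rwa [AlgHom.comp_apply, quotRep_mk_one, Submodule.Quotient.mk_eq_zero] at this

end Surjection

/-! ### Rank one computations with sl2-triples. -/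

section RankOne

variable {A V : Type*} [CommRing A] [AddCommGroup V] [Module ℂ V]

section Strings

variable {E F K : End ℂ V} {v : V} {c : ℂ}

lemma cartan_apply_pow (hKF : K * F - F * K = (-2 : ℂ) • F) (hK : K v = c • v) (n : ℕ) :
    K ((F ^ n) v) = (c - 2 * n) • (F ^ n) v := by
  induction n with
  | zero => simp [hK]
  | succ n ih =>
    have h := LinearMap.congr_fun hKF ((F ^ n) v)
    simp only [LinearMap.sub_apply, Module.End.mul_apply, LinearMap.smul_apply, ih, map_smul,
      sub_eq_iff_eq_add] at h
    rw [pow_succ', Module.End.mul_apply, h]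
    push_cast
    module

lemma raising_apply_pow_succ (hEF : E * F - F * E = K) (hKF : K * F - F * K = (-2 : ℂ) • F)
    (hE : E v = 0) (hK : K v = c • v) (n : ℕ) :
    E ((F ^ (n + 1)) v) = ((n + 1) * (c - n)) • (F ^ n) v := by
  induction n with
  | zero =>
    have h := LinearMap.congr_fun hEF v
    simp only [LinearMap.sub_apply, Module.End.mul_apply, hE, map_zero, sub_zero] at h
    simp [h, hK]
  | succ n ih =>
    have h := LinearMap.congr_fun hEF ((F ^ (n + 1)) v)
    simp only [LinearMap.sub_apply, Module.End.mul_apply, ih, map_smul, sub_eq_iff_eq_add,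
      cartan_apply_pow hKF hK] at h
    rw [pow_succ', Module.End.mul_apply, h, pow_succ', Module.End.mul_apply]
    push_cast
    module

/-- Let n + 1 be the least exponent killing `v`. Then 0 = E F^(n+1) v = (n+1)(c-n) F^n v with F^n v
≠ 0 forces c = n. -/
lemma exists_nat_of_pow_apply_eq_zero (hEF : E * F - F * E = K)
    (hKF : K * F - F * K = (-2 : ℂ) • F) (hE : E v = 0) (hK : K v = c • v) (hv : v ≠ 0) {k : ℕ}
    (hk : (F ^ k) v = 0) : ∃ n : ℕ, c = n ∧ (F ^ (n + 1)) v = 0 := by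
  classical
  have hex : ∃ k, (F ^ k) v = 0 := ⟨k, hk⟩
  obtain ⟨n, hn⟩ : ∃ n, Nat.find hex = n + 1 :=
    Nat.exists_eq_succ_of_ne_zero fun h => hv (by simpa [h] using Nat.find_spec hex)
  have h0 : (F ^ (n + 1)) v = 0 := hn ▸ Nat.find_spec hex
  have h1 : (F ^ n) v ≠ 0 := Nat.find_min hex (by omega)
  have h2 := raising_apply_pow_succ hEF hKF hE hK n
  rw [h0, map_zero, eq_comm, smul_eq_zero, or_iff_left h1, mul_eq_zero,
    or_iff_right (Nat.cast_add_one_ne_zero n), sub_eq_zero] at h2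
  exact ⟨n, h2, h0⟩

end Strings

variable {E F K : A → End ℂ V} {v : V} {P : A}

/-- The vector obtained by applying the operators `F (P ^ k)`, `k` in the list, to `v`. -/
def stringVec (F : A → End ℂ V) (v : V) (P : A) (l : List ℕ) : V :=
  l.foldr (fun k w => F (P ^ k) w) v

/-- Moving `K (P ^ k)` to the right past `F (P ^ a)` adds -2 times the string with `a` replaced by
`a + k`, and at the end it kills `v`. Only the lengths and sums of the resulting lists matter later.
-/
lemma cartan_apply_stringVec
    (hKF : ∀ P Q, K P * F Q - F Q * K P = (-2 : ℂ) • F (P * Q))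
    (hK : ∀ k, 1 ≤ k → K (P ^ k) v = 0) {k : ℕ} (hk : 1 ≤ k) (l : List ℕ) :
    ∃ L : List (List ℕ), L.length = l.length ∧
      (∀ l' ∈ L, l'.length = l.length ∧ l'.sum = l.sum + k) ∧
      K (P ^ k) (stringVec F v P l) = (-2 : ℂ) • (L.map (stringVec F v P)).sum := by
  induction l with
  | nil => exact ⟨[], by simp [stringVec, hK k hk]⟩
  | cons a l ih =>
    obtain ⟨L, hL, hL', hsum⟩ := ih
    refine ⟨((a + k) :: l) :: L.map (a :: ·), by simp [hL], ?_, ?_⟩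
    · intro l' hl'
      rcases List.mem_cons.mp hl' with rfl | hl'
      · simp; ring
      · obtain ⟨l'', h'', rfl⟩ := List.mem_map.mp hl'
        have := hL' l'' h''
        simp only [List.length_cons, List.sum_cons]
        omega
    · have h := LinearMap.congr_fun (hKF (P ^ k) (P ^ a)) (stringVec F v P l)
      simp only [LinearMap.sub_apply, Module.End.mul_apply, LinearMap.smul_apply, hsum,
        map_smul, sub_eq_iff_eq_add, map_list_sum, List.map_map, ← pow_add] at h
      rw [List.map_cons, List.sum_cons, List.map_map, smul_add]
      rw [add_comm a k]
      exact h

/-- Commuting `E P` with `F (P ^ a)` gives `K (P ^ (a + 1))`, which then meets each factor to its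
right. Each pair of factors thus merges into one whose exponent is the sum of the two plus one;
hence the binomial coefficient. -/
lemma raising_apply_stringVec (hEF : ∀ P Q, E P * F Q - F Q * E P = K (P * Q))
    (hKF : ∀ P Q, K P * F Q - F Q * K P = (-2 : ℂ) • F (P * Q)) (hE : E P v = 0)
    (hK : ∀ k, 1 ≤ k → K (P ^ k) v = 0) (l : List ℕ) :
    ∃ L : List (List ℕ), L.length = l.length.choose 2 ∧
      (∀ l' ∈ L, l'.length + 1 = l.length ∧ l'.sum = l.sum + 1) ∧
      E P (stringVec F v P l) = (-2 : ℂ) • (L.map (stringVec F v P)).sum := by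
  induction l with
  | nil => exact ⟨[], by simp [stringVec, hE]⟩
  | cons a l ih =>
    obtain ⟨L, hL, hL', hsum⟩ := ih
    obtain ⟨M, hM, hM', hMsum⟩ :=
      cartan_apply_stringVec hKF hK (k := a + 1) (by omega) l
    refine ⟨M ++ L.map (a :: ·), ?_, ?_, ?_⟩
    · simp [hL, hM, Nat.choose_succ_succ' l.length 1]
    · intro l' hl'
      rcases List.mem_append.mp hl' with hl' | hl'
      · have := hM' l' hl'
        simp only [List.length_cons, List.sum_cons]
        omega
      · obtain ⟨l'', h'', rfl⟩ := List.mem_map.mp hl'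
        have := hL' l'' h''
        simp only [List.length_cons, List.sum_cons]
        omega
    · have h := LinearMap.congr_fun (hEF P (P ^ a)) (stringVec F v P l)
      simp only [LinearMap.sub_apply, Module.End.mul_apply, hsum, ← pow_succ', hMsum,
        map_smul, sub_eq_iff_eq_add, map_list_sum, List.map_map] at h
      rw [List.map_append, List.sum_append, List.map_map, smul_add]
      exact h

/-- Each application of `E P` shortens the strings by one, so after `m` steps every term is the same
vector. All terms of one step enter with the same coefficient, so nothing cancels. -/
lemma raising_pow_apply_stringVec (hEF : ∀ P Q, E P * F Q - F Q * E P = K (P * Q))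
    (hKF : ∀ P Q, K P * F Q - F Q * K P = (-2 : ℂ) • F (P * Q)) (hE : E P v = 0)
    (hK : ∀ k, 1 ≤ k → K (P ^ k) v = 0) (m : ℕ) :
    ∃ c : ℂ, c ≠ 0 ∧ ∀ l : List ℕ, l.length = m + 1 →
      ((E P) ^ m) (stringVec F v P l) = c • F (P ^ (l.sum + m)) v := by
  induction m with
  | zero =>
    refine ⟨1, one_ne_zero, fun l hl => ?_⟩
    obtain ⟨a, rfl⟩ := List.length_eq_one_iff.mp hl
    simp [stringVec]
  | succ m ih =>
    obtain ⟨c, hc, ih⟩ := ih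
    -- One application of `E P` to a string of length m + 2 gives -2 times a sum of `(m + 2).choose
    -- 2` strings of length m + 1, each contributing `c`.
    refine ⟨-2 * ((m + 2).choose 2 * c), mul_ne_zero (by norm_num) (mul_ne_zero
      (Nat.cast_ne_zero.mpr (Nat.choose_pos (by omega)).ne') hc), fun l hl => ?_⟩
    obtain ⟨L, hL, hL', hsum⟩ := raising_apply_stringVec hEF hKF hE hK l
    have h : ∀ w ∈ L.map ((E P ^ m) ∘ stringVec F v P),
        w = c • F (P ^ (l.sum + (m + 1))) v := by
      intro w hw
      obtain ⟨l', hl', rfl⟩ := List.mem_map.mp hw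
      have := hL' l' hl'
      rw [Function.comp_apply, ih l' (by omega), this.2]
      congr 4
      omega
    rw [pow_succ, Module.End.mul_apply, hsum, map_smul, map_list_sum, List.map_map,
      List.eq_replicate_of_mem h, List.sum_replicate, List.length_map, hL, hl, mul_smul, mul_smul,
      Nat.cast_smul_eq_nsmul]

/-- If `v` is killed by `E P` and by `K (P ^ k)` for `k ≥ 1`, then a power of the lowering operator
`F 1` that kills `v` provides a power of `P` with `F (P ^ n) v = 0`. -/
lemma lowering_pow_apply_eq_zero (hEF : ∀ P Q, E P * F Q - F Q * E P = K (P * Q))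
    (hKF : ∀ P Q, K P * F Q - F Q * K P = (-2 : ℂ) • F (P * Q)) (hE : E P v = 0)
    (hK : ∀ k, 1 ≤ k → K (P ^ k) v = 0) {n : ℕ} (hn : ((F 1) ^ (n + 1)) v = 0) :
    F (P ^ n) v = 0 := by
  obtain ⟨c, hc, h⟩ := raising_pow_apply_stringVec hEF hKF hE hK n
  have hrep : ∀ k, stringVec F v P (List.replicate k 0) = ((F 1) ^ k) v := by
    intro k
    induction k with
    | zero => simp [stringVec]
    | succ k ih =>
      rw [List.replicate_succ, pow_succ', Module.End.mul_apply, ← ih]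
      simp [stringVec]
  have := h (List.replicate (n + 1) 0) (by simp)
  rw [hrep, hn, map_zero, eq_comm, smul_eq_zero, or_iff_right hc] at this
  simpa using this

end RankOne

/-! ### Annihilation by a power of the ideal of the points. -/

section Annihilation

variable {A g : Type*} [CommRing A] [Algebra ℂ A] [LieRing g] [LieAlgebra ℂ g]
variable {V : Type*} [AddCommGroup V] [Module ℂ V]

lemma rep_current_comm (ρ : CurrentEnv A g →ₐ[ℂ] End ℂ V) (x y : g) (P Q : A) :
    ρ (current x P) * ρ (current y Q) - ρ (current y Q) * ρ (current x P) =
      ρ (current ⁅x, y⁆ (P * Q)) := by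
  rw [← map_mul, ← map_mul, ← map_sub, current_mul_sub_mul]

/-- If `g ⊗ J` kills a vector, for an ideal `J`, then it kills the submodule it generates. -/
lemma current_apply_eq_zero_of_ideal (ρ : CurrentEnv A g →ₐ[ℂ] End ℂ V) (J : Ideal A) {v : V}
    (hv : ∀ (x : g), ∀ P ∈ J, ρ (current x P) v = 0) (u : CurrentEnv A g) :
    ∀ (x : g), ∀ P ∈ J, ρ (current x P) (ρ u v) = 0 := by
  let S : Subalgebra ℂ (CurrentEnv A g) :=
    { carrier := {u | ∀ w : V, (∀ (x : g), ∀ P ∈ J, ρ (current x P) w = 0) →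
        ∀ (x : g), ∀ P ∈ J, ρ (current x P) (ρ u w) = 0}
      mul_mem' := by
        intro a c ha hc w hw
        rw [map_mul, Module.End.mul_apply]
        exact ha _ (hc w hw)
      add_mem' := by
        intro a c ha hc w hw x P hP
        rw [map_add, LinearMap.add_apply, map_add, ha w hw x P hP, hc w hw x P hP, add_zero]
      algebraMap_mem' := by
        intro r w hw x P hP
        rw [AlgHom.commutes, Module.algebraMap_end_apply, map_smul, hw x P hP, smul_zero] }
  have hS : S = ⊤ := by
    apply subalgebra_eq_top_of_current_mem
    intro y Q w hw x P hP
    have h := LinearMap.congr_fun (rep_current_comm ρ x y P Q) w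
    rw [LinearMap.sub_apply, Module.End.mul_apply, Module.End.mul_apply, hw x P hP, map_zero,
      sub_zero, hw _ _ (J.mul_mem_right Q hP)] at h
    exact h
  have : u ∈ S := hS ▸ Algebra.mem_top
  exact this v hv

variable [FiniteDimensional ℂ g] [IsSemisimple ℂ g]
variable {H : LieSubalgebra ℂ g} [H.IsCartanSubalgebra] {b : (rootSystem H).Base}

/-- The extension of `χ` from the simple coroots to the Cartan subalgebra. -/
def cartanChar (χ : b.support → A →ₗ[ℂ] ℂ) (h : H) : A →ₗ[ℂ] ℂ :=
  ∑ i, b.toCoweightBasis.repr h i • χ i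

lemma IsWeylVector.cartan_apply {χ : b.support → A →ₗ[ℂ] ℂ}
    {ρ : CurrentEnv A g →ₐ[ℂ] End ℂ V} {v : V} (hv : IsWeylVector b χ ρ v) (h : H) (P : A) :
    ρ (current (h : g) P) v = cartanChar χ h P • v := by
  let φ : H →ₗ[ℂ] V := (LinearMap.applyₗ v) ∘ₗ ρ.toLinearMap ∘ₗ currentLin A g ∘ₗ
    (TensorProduct.mk ℂ A g P) ∘ₗ H.toSubmodule.subtype
  have hφ : ∀ h : H, φ h = ρ (current (h : g) P) v := fun h => rfl
  have h1 := congrArg φ (b.toCoweightBasis.sum_repr h)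
  rw [map_sum, hφ] at h1
  rw [← h1, cartanChar, LinearMap.sum_apply, Finset.sum_smul]
  refine Finset.sum_congr rfl fun i _ => ?_
  rw [map_smul, RootPairing.Base.toCoweightBasis_apply, hφ, hv.coroot_apply, smul_smul]
  rfl

lemma cartanChar_eq_zero {χ : b.support → A →ₗ[ℂ] ℂ} {P : A} (hP : ∀ i, χ i P = 0) (h : H) :
    cartanChar χ h P = 0 := by
  simp [cartanChar, hP]

/-- The lowering operator of a positive root is nilpotent on a Weyl vector, with an exponent that
depends only on the character. -/
lemma exists_pow_lowering_eq_zero (χ : b.support → A →ₗ[ℂ] ℂ) {h e f : g}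
    (t : IsSl2Triple h e f) (he : e ∈ nPlus b) (hh : h ∈ H) :
    ∃ n : ℕ, ∀ (V : Type*) [AddCommGroup V] [Module ℂ V] (ρ : CurrentEnv A g →ₐ[ℂ] End ℂ V)
      (v : V), IsWeylVector b χ ρ v → (ρ (current f 1) ^ (n + 1)) v = 0 := by
  have key : ∀ (V : Type _) [AddCommGroup V] [Module ℂ V] (ρ : CurrentEnv A g →ₐ[ℂ] End ℂ V)
      (v : V), IsWeylVector b χ ρ v → v ≠ 0 →
      ∃ n : ℕ, cartanChar χ ⟨h, hh⟩ 1 = n ∧ (ρ (current f 1) ^ (n + 1)) v = 0 := by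
    intro V _ _ ρ v hv hv0
    have hEF := rep_current_comm ρ e f 1 1
    have hKF := rep_current_comm ρ h f 1 1
    rw [t.lie_e_f, one_mul] at hEF
    rw [t.lie_lie_smul_f ℂ, one_mul, ← neg_smul, current_smul_left, map_smul] at hKF
    have hK := hv.cartan_apply ⟨h, hh⟩ 1
    obtain ⟨D, -, hD⟩ := hv.integrable
    -- `D` is finite, so some value in the string c, c - 2, c - 4, ... is taken by no weight in `D`.
    -- The vector (f ⊗ 1)^k v has this eigenvalue, yet lies in the sum of other eigenspaces, so it
    -- vanishes.
    obtain ⟨k, hk⟩ : ∃ k : ℕ, ∀ μ ∈ D, μ ⟨h, hh⟩ ≠ cartanChar χ ⟨h, hh⟩ 1 - 2 * (k : ℂ) := by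
      classical
      have hinj : Function.Injective fun k : ℕ => cartanChar χ ⟨h, hh⟩ 1 - 2 * (k : ℂ) := by
        intro k l hkl
        simpa using hkl
      obtain ⟨_, ⟨k, rfl⟩, hk⟩ := (Set.infinite_range_of_injective hinj).exists_notMem_finset
        (D.image fun μ => μ ⟨h, hh⟩)
      exact ⟨k, fun μ hμ hk' => hk (Finset.mem_image.mpr ⟨μ, hμ, hk'⟩)⟩
    refine exists_nat_of_pow_apply_eq_zero hEF hKF (hv.nPlus_apply e he 1) hK hv0 (k := k) ?_
    have hdisj := (Module.End.eigenspaces_iSupIndep (ρ (current h 1)))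
      (cartanChar χ ⟨h, hh⟩ 1 - 2 * (k : ℂ))
    refine Submodule.disjoint_def.mp hdisj _
      (Module.End.mem_eigenspace_iff.mpr (cartan_apply_pow hKF hK k)) ?_
    have h1 := hD (current f 1 ^ k)
    rw [map_pow] at h1
    suffices hle : ⨆ μ ∈ D, repWeightSpace H ρ μ ≤
        ⨆ c, ⨆ (_ : c ≠ cartanChar χ ⟨h, hh⟩ 1 - 2 * (k : ℂ)),
          Module.End.eigenspace (ρ (current h 1)) c from hle h1
    refine iSup₂_le fun μ hμ => ?_
    refine le_trans ?_ (le_iSup₂_of_le (μ ⟨h, hh⟩) (hk μ hμ) le_rfl)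
    intro w hw
    exact Module.End.mem_eigenspace_iff.mpr (mem_repWeightSpace.mp hw ⟨h, hh⟩)
  by_cases hn : ∃ n : ℕ, cartanChar χ ⟨h, hh⟩ 1 = n
  · obtain ⟨n, hn⟩ := hn
    refine ⟨n, fun V _ _ ρ v hv => ?_⟩
    by_cases hv0 : v = 0
    · rw [hv0, map_zero]
    · obtain ⟨m, hm, hm'⟩ := key V ρ v hv hv0
      rw [hn, Nat.cast_inj] at hm
      rwa [hm]
  -- If h does not act by a natural number, there are no nonzero Weyl vectors and any exponent will
  -- do.
  · refine ⟨0, fun V _ _ ρ v hv => ?_⟩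
    by_cases hv0 : v = 0
    · rw [hv0, map_zero]
    · obtain ⟨m, hm, -⟩ := key V ρ v hv hv0
      exact absurd ⟨m, hm⟩ hn

lemma nPlus_of_isPos {α : H.root} (hα : b.IsPos α) {x : g}
    (hx : x ∈ rootSpace H (α : LieModule.Weight ℂ H g)) : x ∈ nPlus b :=
  Submodule.mem_iSup_of_mem α (Submodule.mem_iSup_of_mem hα hx)

/-- A subspace that contains the positive root spaces, the Cartan subalgebra and a nonzero element
of each negative root space is everything. -/
lemma eq_top_of_nPlus_le (X : Submodule ℂ g) (hpos : nPlus b ≤ X) (hH : H.toSubmodule ≤ X)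
    (hneg : ∀ α : H.root, b.IsPos α → ∃ f ∈ X, f ≠ 0 ∧
      f ∈ rootSpace H (-(α : LieModule.Weight ℂ H g) : H → ℂ)) : X = ⊤ := by
  rw [eq_top_iff]
  have htop := congrArg LieSubmodule.toSubmodule (LieModule.iSup_genWeightSpace_eq_top' ℂ H g)
  rw [LieSubmodule.iSup_toSubmodule, LieSubmodule.top_toSubmodule] at htop
  rw [← htop]
  refine iSup_le fun β => ?_
  by_cases hβ : β.IsZero
  · have h0 : (rootSpace H (β : H → ℂ)) = H.toLieSubmodule := by
      rw [hβ.eq, rootSpace_zero_eq]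
    change (rootSpace H (β : H → ℂ)).toSubmodule ≤ X
    rw [h0]
    exact hH
  · let α : H.root := ⟨β, by simpa using hβ⟩
    rcases RootPairing.Base.IsPos.or_neg (b := b) α with hα | hα
    · exact fun x hx => hpos (nPlus_of_isPos hα hx)
    · let _ := (rootSystem H).indexNeg
      obtain ⟨f, hfX, hf0, hf⟩ := hneg (-α) hα
      have hroot : (((-α : H.root) : LieModule.Weight ℂ H g) : H → ℂ) = -(β : H → ℂ) := by
        have h1 : (rootSystem H).root (-α) = -(rootSystem H).root α := by
          change (rootSystem H).root ((rootSystem H).reflectionPerm α α) = _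
          rw [RootPairing.root_reflectionPerm, RootPairing.reflection_apply_self]
        funext h
        exact LinearMap.congr_fun h1 h
      rw [hroot, neg_neg] at hf
      intro x hx
      obtain ⟨c, hc⟩ := (finrank_eq_one_iff_of_nonzero' (⟨f, hf⟩ : rootSpace H (β : H → ℂ))
        (by simpa using hf0)).mp (finrank_rootSpace_eq_one β hβ) ⟨x, hx⟩
      have hc' : c • f = x := congrArg Subtype.val hc
      rw [← hc']
      exact X.smul_mem c hfX

/-- The functions P with (f ⊗ P) v = 0 form an ideal: h ⊗ Q acts on v by a scalar and [h ⊗ Q, f ⊗ P]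
= -2 f ⊗ QP. The rank one computation puts P^n into it for P in `J`, as the characters vanish on all
positive powers of P. -/
lemma IsWeylVector.lowering_apply_eq_zero {χ : b.support → A →ₗ[ℂ] ℂ}
    {ρ : CurrentEnv A g →ₐ[ℂ] End ℂ V} {v : V} (hv : IsWeylVector b χ ρ v) {h e f : g}
    (t : IsSl2Triple h e f) (he : e ∈ nPlus b) (hh : h ∈ H) (J : Ideal A)
    (hJ : ∀ P ∈ J, ∀ i, χ i P = 0) {n m : ℕ} (hn : (ρ (current f 1) ^ (n + 1)) v = 0)
    (hnm : n ≤ m) :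
    ∀ P ∈ Ideal.span ((fun P => P ^ m) '' (J : Set A)), ρ (current f P) v = 0 := by
  have hKF : ∀ P Q, ρ (current h P) * ρ (current f Q) -
      ρ (current f Q) * ρ (current h P) =
      (-2 : ℂ) • ρ (current f (P * Q)) := by
    intro P Q
    rw [rep_current_comm, t.lie_lie_smul_f ℂ, ← neg_smul, current_smul_left, map_smul]
  have hEF : ∀ P Q, ρ (current e P) * ρ (current f Q) -
      ρ (current f Q) * ρ (current e P) =
      ρ (current h (P * Q)) := by
    intro P Q
    rw [rep_current_comm, t.lie_e_f]
  have hK : ∀ P, ρ (current h P) v = cartanChar χ ⟨h, hh⟩ P • v :=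
    fun P => hv.cartan_apply ⟨h, hh⟩ P
  let Jα : Ideal A :=
    { carrier := {P | ρ (current f P) v = 0}
      zero_mem' := by
        change ρ (current f 0) v = 0
        rw [current_zero_right, map_zero, LinearMap.zero_apply]
      add_mem' := fun {P Q} hP hQ => by
        change ρ (current f (P + Q)) v = 0
        rw [current_add_right, map_add, LinearMap.add_apply, hP, hQ, add_zero]
      smul_mem' := fun Q P hP => by
        change ρ (current f (Q * P)) v = 0
        have h1 := LinearMap.congr_fun (hKF Q P) v
        have hP' : ρ (current f P) v = 0 := hP
        rw [LinearMap.sub_apply, Module.End.mul_apply, Module.End.mul_apply, hP', map_zero,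
          hK, map_smul, hP', smul_zero, sub_zero, LinearMap.smul_apply, eq_comm,
          smul_eq_zero, or_iff_right (by norm_num)] at h1
        exact h1 }
  have hJα : Ideal.span ((fun P => P ^ m) '' (J : Set A)) ≤ Jα := by
    rw [Ideal.span_le]
    rintro _ ⟨P, hP, rfl⟩
    have h1 : P ^ n ∈ Jα :=
      lowering_pow_apply_eq_zero (E := fun P => ρ (current e P))
        (F := fun P => ρ (current f P))
        (K := fun P => ρ (current h P)) (v := v) (P := P) hEF hKF
        (hv.nPlus_apply _ he P)
        (fun k hk => by
          rw [hK, cartanChar_eq_zero fun i => hJ _ (J.pow_mem_of_mem hP k hk) i, zero_smul])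
        hn
    change P ^ m ∈ Jα
    rw [← Nat.sub_add_cancel hnm, pow_add]
    exact Jα.mul_mem_left _ h1
  exact fun P hP => hJα hP

lemma exists_isSl2Triple_of_root (α : H.root) : ∃ h e f : g, IsSl2Triple h e f ∧
    e ∈ rootSpace H (α : LieModule.Weight ℂ H g) ∧
    f ∈ rootSpace H (-(α : LieModule.Weight ℂ H g) : H → ℂ) ∧ h ∈ H := by
  have hα : (α : LieModule.Weight ℂ H g).IsNonZero := (Finset.mem_filter.mp α.2).2
  obtain ⟨h, e, f, t, he, hf⟩ := exists_isSl2Triple_of_weight_isNonZero hα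
  exact ⟨h, e, f, t, he, hf, by rw [t.h_eq_coroot hα he hf]; exact Subtype.property _⟩

/-- The exponent for each root depends on `χ` alone, so the maximum over the finitely many roots
works for all `I` at once. -/
lemma exists_pow_lowering_annihilates (χ : b.support → A →ₗ[ℂ] ℂ) (J : Ideal A)
    (hJ : ∀ P ∈ J, ∀ i, χ i P = 0) :
    ∃ (m : ℕ) (f : H.root → g), ∀ α, b.IsPos α → f α ≠ 0 ∧
      f α ∈ rootSpace H (-(α : LieModule.Weight ℂ H g) : H → ℂ) ∧
      ∀ (I : Submodule (CurrentEnv A g) (CurrentEnv A g)), IsWeylQuotient b χ I →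
        ∀ P ∈ Ideal.span ((fun P => P ^ m) '' (J : Set A)),
          quotRep I (current (f α) P) (Submodule.Quotient.mk 1) = 0 := by
  choose h e f t he hf hh using exists_isSl2Triple_of_root (H := H)
  have hex : ∀ α : H.root, ∃ n : ℕ, b.IsPos α →
      ∀ (I : Submodule (CurrentEnv A g) (CurrentEnv A g)), IsWeylQuotient b χ I →
      (quotRep I (current (f α) 1) ^ (n + 1)) (Submodule.Quotient.mk 1) = 0 := by
    intro α
    by_cases hα : b.IsPos α
    · obtain ⟨n, hn⟩ := exists_pow_lowering_eq_zero χ (t α) (nPlus_of_isPos hα (he α)) (hh α)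
      exact ⟨n, fun _ I hI => hn _ _ _ hI⟩
    · exact ⟨0, fun h => absurd h hα⟩
  choose n hn using hex
  refine ⟨Finset.univ.sup n, f, fun α hα => ⟨(t α).f_ne_zero, hf α, fun I hI => ?_⟩⟩
  exact IsWeylVector.lowering_apply_eq_zero hI (t α) (nPlus_of_isPos hα (he α)) (hh α) J hJ
    (hn α hα I hI) (Finset.le_sup (f := n) (Finset.mem_univ α))

/-- If all the functionals `χ i` vanish on an ideal `J` of a noetherian algebra, then `g ⊗ J ^ N`
annihilates all modules generated by a Weyl vector, for a suitable `N`. -/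
theorem exists_pow_annihilates [IsNoetherianRing A] (χ : b.support → A →ₗ[ℂ] ℂ) (J : Ideal A)
    (hJ : ∀ P ∈ J, ∀ i, χ i P = 0) :
    ∃ N : ℕ, ∀ M, N ≤ M → ∀ I : Submodule (CurrentEnv A g) (CurrentEnv A g),
      IsWeylQuotient b χ I → ∀ (x : g), ∀ P ∈ J ^ M, quotRep I (current x P) = 0 := by
  obtain ⟨m, f, hf⟩ := exists_pow_lowering_annihilates χ J hJ
  -- `J` lies in the radical of the ideal generated by its m-th powers and is finitely generated, so
  -- a power of `J` lies in that ideal.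
  obtain ⟨N, hN⟩ := Ideal.exists_pow_le_of_le_radical_of_fg
    (I := J) (J := Ideal.span ((fun P => P ^ m) '' (J : Set A)))
    (fun P hP => ⟨m, Ideal.subset_span ⟨P, hP, rfl⟩⟩) (IsNoetherian.noetherian J)
  -- The shift makes `M` positive, so that `J ^ M ≤ J` and the characters vanish on `J ^ M`.
  refine ⟨N + 1, fun M hM I hI => ?_⟩
  have hle : J ^ M ≤ Ideal.span ((fun P => P ^ m) '' (J : Set A)) :=
    (Ideal.pow_le_pow_right (by omega)).trans hN
  have hle' : J ^ M ≤ J := Ideal.pow_le_self (by omega)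
  have hI' : IsWeylVector b χ (quotRep I) (Submodule.Quotient.mk 1) := hI
  let X : Submodule ℂ g :=
    { carrier := {x | ∀ P ∈ J ^ M, quotRep I (current x P) (Submodule.Quotient.mk 1) = 0}
      zero_mem' := fun P _ => by rw [current_zero_left, map_zero, LinearMap.zero_apply]
      add_mem' := fun hx hy P hP => by
        rw [current_add_left, map_add, LinearMap.add_apply, hx P hP, hy P hP, add_zero]
      smul_mem' := fun c x hx P hP => by
        rw [current_smul_left, map_smul, LinearMap.smul_apply, hx P hP, smul_zero] }
  have hX : X = ⊤ := by
    refine eq_top_of_nPlus_le (b := b) X (fun x hx P _ => hI'.nPlus_apply x hx P)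
      (fun x hx P hP => ?_) fun α hα => ⟨f α, ?_, (hf α hα).1, (hf α hα).2.1⟩
    · rw [hI'.cartan_apply ⟨x, hx⟩, cartanChar_eq_zero (fun i => hJ P (hle' hP) i), zero_smul]
    · exact fun P hP => (hf α hα).2.2 I hI P (hle hP)
  have hv : ∀ (x : g), ∀ P ∈ J ^ M, quotRep I (current x P) (Submodule.Quotient.mk 1) = 0 :=
    fun x => Submodule.eq_top_iff'.mp hX x
  intro x P hP
  refine LinearMap.ext fun w => ?_
  obtain ⟨u, rfl⟩ := Submodule.Quotient.mk_surjective I w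
  have := current_apply_eq_zero_of_ideal (quotRep I) (J ^ M) hv u x P hP
  rwa [quotRep_mk_one] at this

end Annihilation

/-! ### Tensor products of quotients and intersections of kernels. -/

section LinearAlgebra

variable {X U Y : Type*} [AddCommGroup X] [Module ℂ X] [AddCommGroup U] [Module ℂ U]
  [AddCommGroup Y] [Module ℂ Y]

lemma eq_zero_of_forall_lTensor_dual (t : X ⊗[ℂ] Y) (h : ∀ φ : Dual ℂ Y, φ.lTensor X t = 0) :
    t = 0 := by
  classical
  let B := Basis.ofVectorSpace ℂ Y
  apply (TensorProduct.equivFinsuppOfBasisRight (M := X) B).injective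
  rw [map_zero]
  ext k
  have key : ∀ t : X ⊗[ℂ] Y, TensorProduct.equivFinsuppOfBasisRight (M := X) B t k =
      TensorProduct.rid ℂ X ((B.coord k).lTensor X t) := by
    intro t
    induction t using TensorProduct.induction_on with
    | zero => simp
    | add a c ha hc => simp only [map_add, Finsupp.add_apply, ha, hc]
    | tmul a c => simp
  rw [key, h, map_zero, Finsupp.zero_apply]

lemma rid_lTensor_map {N : Type*} [AddCommGroup N] [Module ℂ N] (r : U →ₗ[ℂ] N) (f : X →ₗ[ℂ] Y)
    (φ : Dual ℂ Y) (t : U ⊗[ℂ] X) :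
    TensorProduct.rid ℂ N (φ.lTensor N (TensorProduct.map r f t)) =
      r (TensorProduct.rid ℂ U ((φ ∘ₗ f).lTensor U t)) := by
  induction t using TensorProduct.induction_on with
  | zero => simp
  | add a c ha hc => simp only [map_add, ha, hc]
  | tmul a c => simp

/-- Kernels of tensor products of linear maps are compatible with intersections of kernels. -/
lemma map_apply_eq_zero_of_forall {ι : Type*} {M : ι → Type*} {M' : Type*}
    [∀ i, AddCommGroup (M i)] [∀ i, Module ℂ (M i)] [AddCommGroup M'] [Module ℂ M']
    (f : X →ₗ[ℂ] Y) (q : ∀ i, U →ₗ[ℂ] M i) (q' : U →ₗ[ℂ] M')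
    (hq : ∀ u, (∀ i, q i u = 0) → q' u = 0) (t : U ⊗[ℂ] X)
    (ht : ∀ i, TensorProduct.map (q i) f t = 0) : TensorProduct.map q' f t = 0 := by
  apply eq_zero_of_forall_lTensor_dual
  -- Contracting the second factor with `φ` reduces the claim to a single element of `U`, to which
  -- `hq` applies.
  intro φ
  apply (TensorProduct.rid ℂ M').injective
  rw [rid_lTensor_map, map_zero]
  apply hq
  intro i
  rw [← rid_lTensor_map, ht, map_zero, map_zero]

lemma map_apply_eq_zero_of_forall' {ι : Type*} {M : ι → Type*} {M' : Type*}
    [∀ i, AddCommGroup (M i)] [∀ i, Module ℂ (M i)] [AddCommGroup M'] [Module ℂ M']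
    (f : X →ₗ[ℂ] Y) (q : ∀ i, U →ₗ[ℂ] M i) (q' : U →ₗ[ℂ] M')
    (hq : ∀ u, (∀ i, q i u = 0) → q' u = 0) (t : X ⊗[ℂ] U)
    (ht : ∀ i, TensorProduct.map f (q i) t = 0) : TensorProduct.map f q' t = 0 := by
  have hcomm : ∀ {N : Type _} [AddCommGroup N] [Module ℂ N] (r : U →ₗ[ℂ] N),
      TensorProduct.map r f (TensorProduct.comm ℂ X U t) = 0 ↔ TensorProduct.map f r t = 0 := by
    intro N _ _ r
    rw [TensorProduct.map_comm, EmbeddingLike.map_eq_zero_iff]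
  have hcomm' : TensorProduct.map q' f (TensorProduct.comm ℂ X U t) = 0 ↔
      TensorProduct.map f q' t = 0 := by
    rw [TensorProduct.map_comm, EmbeddingLike.map_eq_zero_iff]
  exact hcomm'.mp (map_apply_eq_zero_of_forall f q q' hq _ fun i => (hcomm (q i)).mpr (ht i))

/-- The projection of an algebra to its quotient by a left ideal, as a `ℂ`-linear map. -/
def quotMk {U : Type*} [Ring U] [Algebra ℂ U] (I : Submodule U U) : U →ₗ[ℂ] U ⧸ I :=
  I.mkQ.restrictScalars ℂ

section Ideals

variable {U₁ U₂ U : Type*} [Ring U₁] [Algebra ℂ U₁] [Ring U₂] [Algebra ℂ U₂] [Ring U] [Algebra ℂ U]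

lemma quotMk_surjective (I : Submodule U U) : Function.Surjective (quotMk I) :=
  fun x => Submodule.Quotient.mk_surjective I x

lemma quotMk_eq_zero {I : Submodule U U} {u : U} : quotMk I u = 0 ↔ u ∈ I :=
  Submodule.Quotient.mk_eq_zero I

/-- The kernel of a tensor product of surjections is the sum of the images of I₁ ⊗ U₂ and U₁ ⊗ I₂.
-/
lemma mem_of_map_quotMk_eq_zero {I₁ : Submodule U₁ U₁} {I₂ : Submodule U₂ U₂} {I : Submodule U U}
    (j : U₁ ⊗[ℂ] U₂ →ₗ[ℂ] U) (h₁ : ∀ a ∈ I₁, ∀ c, j (a ⊗ₜ c) ∈ I)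
    (h₂ : ∀ c ∈ I₂, ∀ a, j (a ⊗ₜ c) ∈ I) {t : U₁ ⊗[ℂ] U₂}
    (ht : TensorProduct.map (quotMk I₁) (quotMk I₂) t = 0) : j t ∈ I := by
  have hker₁ : Function.Exact (I₁.restrictScalars ℂ).subtype (quotMk I₁) := by
    intro a
    rw [quotMk_eq_zero]
    simp
  have hker₂ : Function.Exact (I₂.restrictScalars ℂ).subtype (quotMk I₂) := by
    intro a
    rw [quotMk_eq_zero]
    simp
  rw [← LinearMap.mem_ker, TensorProduct.map_ker hker₁ (quotMk_surjective _) hker₂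
    (quotMk_surjective _)] at ht
  suffices hle : LinearMap.range (LinearMap.lTensor U₁ (I₂.restrictScalars ℂ).subtype) ⊔
      LinearMap.range (LinearMap.rTensor U₂ (I₁.restrictScalars ℂ).subtype) ≤
      (I.restrictScalars ℂ).comap j from hle ht
  refine sup_le ?_ ?_
  · rintro _ ⟨t, rfl⟩
    induction t using TensorProduct.induction_on with
    | zero => simp
    | add a c ha hc => rw [map_add]; exact add_mem ha hc
    | tmul a c => exact h₂ c c.2 a
  · rintro _ ⟨t, rfl⟩
    induction t using TensorProduct.induction_on with
    | zero => simp
    | add a c ha hc => rw [map_add]; exact add_mem ha hc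
    | tmul a c => exact h₁ a a.2 c

/-- Needed because Weyl ideals are infima: vanishing can be tested on pairs of Weyl quotients. The
intersections are taken in one tensor factor at a time. -/
lemma map_quotMk_sInf_eq_zero {S₁ : Set (Submodule U₁ U₁)} {S₂ : Set (Submodule U₂ U₂)}
    {t : U₁ ⊗[ℂ] U₂}
    (ht : ∀ I₁ ∈ S₁, ∀ I₂ ∈ S₂, TensorProduct.map (quotMk I₁) (quotMk I₂) t = 0) :
    TensorProduct.map (quotMk (sInf S₁)) (quotMk (sInf S₂)) t = 0 := by
  refine map_apply_eq_zero_of_forall _ (fun I : S₁ => quotMk (I : Submodule U₁ U₁)) _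
    (fun a ha => ?_) _ fun I₁ => ?_
  · rw [quotMk_eq_zero, Submodule.mem_sInf]
    exact fun I hI => quotMk_eq_zero.mp (ha ⟨I, hI⟩)
  · refine map_apply_eq_zero_of_forall' _ (fun I : S₂ => quotMk (I : Submodule U₂ U₂)) _
      (fun a ha => ?_) _ fun I₂ => ht I₁ I₁.2 I₂ I₂.2
    rw [quotMk_eq_zero, Submodule.mem_sInf]
    exact fun I hI => quotMk_eq_zero.mp (ha ⟨I, hI⟩)

lemma nonempty_quotient_equiv_tensor (L : Submodule U U) (L₁ : Submodule U₁ U₁)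
    (L₂ : Submodule U₂ U₂) (f : U →ₗ[ℂ] U₁ ⊗[ℂ] U₂) (hf : Function.Surjective f)
    (h : ∀ u, TensorProduct.map (quotMk L₁) (quotMk L₂) (f u) = 0 ↔ u ∈ L) :
    Nonempty ((U ⧸ L) ≃ₗ[ℂ] (U₁ ⧸ L₁) ⊗[ℂ] (U₂ ⧸ L₂)) :=
  nonempty_quotient_equiv_of_surjective _
    (TensorProduct.map (quotMk L₁) (quotMk L₂) ∘ₗ f)
    ((TensorProduct.map_surjective (quotMk_surjective _) (quotMk_surjective _)).comp hf) h

end Ideals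

end LinearAlgebra

/-! ### The weight lattice. -/

section WeightLattice

variable {g : Type*} [LieRing g] [LieAlgebra ℂ g] [FiniteDimensional ℂ g] [IsSemisimple ℂ g]
variable {H : LieSubalgebra ℂ g} [H.IsCartanSubalgebra]

lemma add_mem_weightLattice {μ ν : Dual ℂ H} (hμ : μ ∈ weightLattice H)
    (hν : ν ∈ weightLattice H) : μ + ν ∈ weightLattice H := by
  intro α
  obtain ⟨m, hm⟩ := hμ α
  obtain ⟨n, hn⟩ := hν α
  exact ⟨m + n, by rw [LinearMap.add_apply, hm, hn, Int.cast_add]⟩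

lemma sub_mem_weightLattice {μ ν : Dual ℂ H} (hμ : μ ∈ weightLattice H)
    (hν : ν ∈ weightLattice H) : μ - ν ∈ weightLattice H := by
  intro α
  obtain ⟨m, hm⟩ := hμ α
  obtain ⟨n, hn⟩ := hν α
  exact ⟨m - n, by rw [LinearMap.sub_apply, hm, hn, Int.cast_sub]⟩

lemma mem_weightLattice_of_base (b : (rootSystem H).Base) {μ : Dual ℂ H}
    (h : ∀ i : b.support, ∃ n : ℤ, μ ((rootSystem H).coroot i) = n) : μ ∈ weightLattice H := by
  intro α
  have hα := b.coroot_mem_span_int α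
  generalize (rootSystem H).coroot α = y at hα
  induction hα using Submodule.span_induction with
  | mem x hx =>
    obtain ⟨i, hi, rfl⟩ := hx
    exact h ⟨i, hi⟩
  | zero => exact ⟨0, by simp⟩
  | add x y _ _ hx hy =>
    obtain ⟨m, hm⟩ := hx
    obtain ⟨n, hn⟩ := hy
    exact ⟨m + n, by rw [map_add, hm, hn, Int.cast_add]⟩
  | smul c x _ hx =>
    obtain ⟨m, hm⟩ := hx
    exact ⟨c * m, by rw [map_zsmul, hm, zsmul_eq_mul, Int.cast_mul]⟩

end WeightLattice

/-! ### Restriction of Weyl vectors to a factor of a product. -/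

section Restriction

variable {A C g : Type*} [CommRing A] [Algebra ℂ A] [CommRing C] [Algebra ℂ C]
  [LieRing g] [LieAlgebra ℂ g]

lemma commute_of_current_commute {R : Type*} [Ring R]
    [Algebra ℂ R] (F : CurrentEnv A g →ₐ[ℂ] R) (r : R)
    (h : ∀ (x : g) (P : A), Commute (F (current x P)) r) (u : CurrentEnv A g) :
    Commute (F u) r := by
  have : (Subalgebra.centralizer ℂ {r}).comap F = ⊤ := by
    apply subalgebra_eq_top_of_current_mem
    intro x P
    rw [Subalgebra.mem_comap, Subalgebra.mem_centralizer_iff]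
    rintro _ rfl
    exact (h x P).eq.symm
  have hu : u ∈ (Subalgebra.centralizer ℂ {r}).comap F := this ▸ Algebra.mem_top
  rw [Subalgebra.mem_comap, Subalgebra.mem_centralizer_iff] at hu
  exact (hu r rfl).symm

variable [FiniteDimensional ℂ g] [IsSemisimple ℂ g]
variable {H : LieSubalgebra ℂ g} [H.IsCartanSubalgebra] {b : (rootSystem H).Base}
variable {V : Type*} [AddCommGroup V] [Module ℂ V]

/-- The weight through which the Cartan subalgebra acts on a Weyl vector after multiplication by a
function `e`. -/
def charWeight (χ : b.support → C →ₗ[ℂ] ℂ) (e : C) : Dual ℂ H :=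
  ∑ i, χ i e • b.toCoweightBasis.coord i

lemma charWeight_apply (χ : b.support → C →ₗ[ℂ] ℂ) (e : C) (h : H) :
    charWeight χ e h = cartanChar χ h e := by
  simp [charWeight, cartanChar, LinearMap.sum_apply, mul_comm]

lemma charWeight_mem_weightLattice {χ : b.support → C →ₗ[ℂ] ℂ} {e : C}
    (h : ∀ i, ∃ n : ℤ, χ i e = n) : charWeight χ e ∈ weightLattice H := by
  classical
  refine mem_weightLattice_of_base b fun i => ?_
  obtain ⟨n, hn⟩ := h i
  refine ⟨n, ?_⟩
  rw [charWeight, LinearMap.sum_apply, ← RootPairing.Base.toCoweightBasis_apply, ← hn,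
    Finset.sum_eq_single i]
  · rw [LinearMap.smul_apply, Basis.coord_apply, Basis.repr_self, Finsupp.single_eq_same,
      smul_eq_mul, mul_one]
  · intro j _ hj
    rw [LinearMap.smul_apply, Basis.coord_apply, Basis.repr_self,
      Finsupp.single_eq_of_ne hj, smul_zero]
  · exact fun hi => absurd (Finset.mem_univ i) hi

/-- Restriction of a Weyl vector along the inclusion of a factor of a product of algebras, where
`e` is the complementary idempotent. -/
lemma IsWeylVector.comp_inclusion {χ : b.support → C →ₗ[ℂ] ℂ}
    {ρ : CurrentEnv C g →ₐ[ℂ] End ℂ V} {v : V} (hv : IsWeylVector b χ ρ v) (φ : A →ₙₐ[ℂ] C)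
    (e : C) (he : φ 1 + e = 1) (hφe : ∀ P, φ P * e = 0) (hχ : ∀ i, ∃ n : ℤ, χ i e = n) :
    IsWeylVector b (fun i => χ i ∘ₗ (φ : A →ₗ[ℂ] C)) (ρ.comp (currentMap φ)) v := by
  obtain ⟨D, hD, hDv⟩ := hv.integrable
  refine ⟨fun x hx P => ?_, fun i P => ?_, ?_⟩
  · rw [AlgHom.comp_apply, currentMap_current, hv.nPlus_apply x hx]
  · rw [AlgHom.comp_apply, currentMap_current, hv.coroot_apply]
    rfl
  · classical
    -- The unit of `A` acts through h ⊗ φ(1) = h ⊗ 1 - h ⊗ e. Since φ(P) e = 0, h ⊗ e commutes with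
    -- the image of U(g ⊗ A), so on the submodule generated by `v` it acts by its scalar on `v`; all
    -- weights shift by it.
    refine ⟨D.image fun μ => μ - charWeight χ e, ?_, fun u => ?_⟩
    · intro ν hν
      obtain ⟨μ, hμ, rfl⟩ := Finset.mem_image.mp (Finset.mem_coe.mp hν)
      exact sub_mem_weightLattice (hD hμ) (charWeight_mem_weightLattice hχ)
    · let p : Submodule ℂ V := ⨅ h : H,
        LinearMap.ker (ρ (current (h : g) e) - algebraMap ℂ (End ℂ V) (charWeight χ e h))
      have hp : ∀ w, w ∈ p ↔ ∀ h : H, ρ (current (h : g) e) w = charWeight χ e h • w := by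
        intro w
        simp [p, sub_eq_zero]
      have hup : ρ (currentMap φ u) v ∈ p := by
        rw [hp]
        intro h
        have hc : Commute ((ρ.comp (currentMap φ)) u) (ρ (current (h : g) e)) := by
          refine commute_of_current_commute _ _ (fun x P => ?_) u
          rw [AlgHom.comp_apply, currentMap_current, Commute, SemiconjBy, ← sub_eq_zero,
            rep_current_comm, hφe, current_zero_right, map_zero]
        have h1 := LinearMap.congr_fun hc.eq v
        simp only [Module.End.mul_apply, AlgHom.comp_apply] at h1
        rw [← h1, hv.cartan_apply, map_smul, charWeight_apply]
      obtain ⟨w, hw, hsum⟩ := (mem_biSup_iff_exists_sum _ _ _).mp (hDv (currentMap φ u))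
      -- The weight components of the vector may leave the submodule generated under g ⊗ A, but not
      -- the eigenspace `p`, which is stable because the Cartan subalgebra is abelian.
      have hmem := mem_of_sum_mem_of_stable (fun h : H => ρ (current (h : g) 1)) p
        (by
          intro h w hw
          rw [hp] at hw ⊢
          intro h'
          have h1 := LinearMap.congr_fun (rep_current_comm ρ (h : g) (h' : g) 1 e) w
          have h0 : ⁅(h : g), (h' : g)⁆ = 0 := by
            rw [← LieSubalgebra.coe_bracket, trivial_lie_zero, ZeroMemClass.coe_zero]
          rw [h0, current_zero_left, map_zero, LinearMap.zero_apply, LinearMap.sub_apply,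
            sub_eq_zero, Module.End.mul_apply, Module.End.mul_apply] at h1
          rw [← h1, hw h', map_smul]) D w
        (fun μ hμ h => mem_repWeightSpace.mp (hw μ hμ) h) (by rw [hsum]; exact hup)
      rw [AlgHom.comp_apply, ← hsum]
      refine Submodule.sum_mem _ fun μ hμ => ?_
      refine Submodule.mem_iSup_of_mem (μ - charWeight χ e) (Submodule.mem_iSup_of_mem
        (Finset.mem_image_of_mem _ hμ) ?_)
      rw [mem_repWeightSpace]
      intro h
      have h1 := mem_repWeightSpace.mp (hw μ hμ) h
      rw [← he, current_add_right, map_add, LinearMap.add_apply, (hp _).mp (hmem μ hμ) h] at h1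
      rw [AlgHom.comp_apply, currentMap_current, LinearMap.sub_apply, sub_smul, ← h1,
        add_sub_cancel_right]

lemma IsWeylQuotient.currentMap_mem {χ : b.support → C →ₗ[ℂ] ℂ}
    {I : Submodule (CurrentEnv C g) (CurrentEnv C g)} (hI : IsWeylQuotient b χ I)
    (φ : A →ₙₐ[ℂ] C) (e : C) (he : φ 1 + e = 1) (hφe : ∀ P, φ P * e = 0)
    (hχ : ∀ i, ∃ n : ℤ, χ i e = n) {χ' : b.support → A →ₗ[ℂ] ℂ}
    (hχ' : ∀ i P, χ i (φ P) = χ' i P) {a : CurrentEnv A g} (ha : a ∈ weylIdeal b χ') :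
    currentMap φ a ∈ I := by
  have hw := hI.comp_inclusion φ e he hφe hχ
  have h : (fun i => χ i ∘ₗ (φ : A →ₗ[ℂ] C)) = χ' := funext fun i => LinearMap.ext (hχ' i)
  rw [h] at hw
  have := hw.apply_eq_zero ha
  rwa [AlgHom.comp_apply, quotRep_mk_one, Submodule.Quotient.mk_eq_zero] at this

end Restriction

/-! ### Local Weyl modules over a product of algebras. -/

section Product

variable {A₁ A₂ g : Type*} [CommRing A₁] [Algebra ℂ A₁] [CommRing A₂] [Algebra ℂ A₂]
  [LieRing g] [LieAlgebra ℂ g]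

variable (A₁ A₂ g) in
/-- The isomorphism from the enveloping algebra of `g ⊗ (A₁ × A₂)` to the tensor product, as a
homomorphism. -/
def currentProdHom : CurrentEnv (A₁ × A₂) g →ₐ[ℂ] CurrentEnv A₁ g ⊗[ℂ] CurrentEnv A₂ g :=
  liftCurrent
    ((Algebra.TensorProduct.includeLeft : CurrentEnv A₁ g →ₐ[ℂ]
        CurrentEnv A₁ g ⊗[ℂ] CurrentEnv A₂ g).toLinearMap ∘ₗ currentLin A₁ g ∘ₗ
        (LinearMap.fst ℂ A₁ A₂).rTensor g +
      (Algebra.TensorProduct.includeRight : CurrentEnv A₂ g →ₐ[ℂ]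
        CurrentEnv A₁ g ⊗[ℂ] CurrentEnv A₂ g).toLinearMap ∘ₗ currentLin A₂ g ∘ₗ
        (LinearMap.snd ℂ A₁ A₂).rTensor g)
    (by
      intro x y P Q
      simp only [LinearMap.add_apply, LinearMap.comp_apply, LinearMap.rTensor_tmul,
        currentLin_tmul, AlgHom.toLinearMap_apply, Algebra.TensorProduct.includeLeft_apply,
        Algebra.TensorProduct.includeRight_apply, add_mul, mul_add,
        Algebra.TensorProduct.tmul_mul_tmul, one_mul, mul_one, LinearMap.fst_apply,
        LinearMap.snd_apply, Prod.fst_mul, Prod.snd_mul, ← current_mul_sub_mul,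
        TensorProduct.sub_tmul, TensorProduct.tmul_sub]
      abel)

@[simp]
lemma currentProdHom_current (x : g) (P : A₁ × A₂) :
    currentProdHom A₁ A₂ g (current x P) = current x P.1 ⊗ₜ 1 + 1 ⊗ₜ current x P.2 :=
  liftCurrent_current _ _ _ _

variable (A₁ A₂ g) in
/-- The inverse of `currentProdHom`. -/
def currentProdInv : CurrentEnv A₁ g ⊗[ℂ] CurrentEnv A₂ g →ₐ[ℂ] CurrentEnv (A₁ × A₂) g :=
  Algebra.TensorProduct.lift (currentMap (NonUnitalAlgHom.inl ℂ A₁ A₂))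
    (currentMap (NonUnitalAlgHom.inr ℂ A₁ A₂)) (by
      intro u w
      refine commute_of_current_commute _ _ (fun x P => ?_) u
      refine (commute_of_current_commute _ _ (fun y Q => ?_) w).symm
      rw [currentMap_current, currentMap_current, Commute, SemiconjBy, ← sub_eq_zero,
        current_mul_sub_mul]
      simp only [NonUnitalAlgHom.inl_apply, NonUnitalAlgHom.inr_apply, Prod.mk_mul_mk, mul_zero,
        zero_mul, Prod.mk_zero_zero, current_zero_right])

lemma currentProdInv_tmul (u : CurrentEnv A₁ g) (w : CurrentEnv A₂ g) :
    currentProdInv A₁ A₂ g (u ⊗ₜ w) =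
      currentMap (NonUnitalAlgHom.inl ℂ A₁ A₂) u * currentMap (NonUnitalAlgHom.inr ℂ A₁ A₂) w :=
  rfl

lemma currentProdInv_currentProdHom (u : CurrentEnv (A₁ × A₂) g) :
    currentProdInv A₁ A₂ g (currentProdHom A₁ A₂ g u) = u := by
  have : (currentProdInv A₁ A₂ g).comp (currentProdHom A₁ A₂ g) = AlgHom.id ℂ _ := by
    apply currentEnv_algHom_ext
    intro x P
    rw [AlgHom.comp_apply, currentProdHom_current, map_add, currentProdInv_tmul,
      currentProdInv_tmul, map_one, map_one, mul_one, one_mul, currentMap_current,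
      currentMap_current, ← current_add_right]
    simp
  exact DFunLike.congr_fun this u

lemma currentProdHom_surjective : Function.Surjective (currentProdHom A₁ A₂ g) := by
  have h1 : ∀ u : CurrentEnv A₁ g, u ⊗ₜ[ℂ] (1 : CurrentEnv A₂ g) ∈
      (currentProdHom A₁ A₂ g).range := by
    have : (currentProdHom A₁ A₂ g).range.comap
        (Algebra.TensorProduct.includeLeft : CurrentEnv A₁ g →ₐ[ℂ]
          CurrentEnv A₁ g ⊗[ℂ] CurrentEnv A₂ g) = ⊤ :=
      subalgebra_eq_top_of_current_mem _ fun x P =>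
        ⟨current x (P, 0), by
          refine (currentProdHom_current x _).trans ?_
          rw [current_zero_right, TensorProduct.tmul_zero, add_zero]; rfl⟩
    intro u
    have hu : u ∈ (⊤ : Subalgebra ℂ (CurrentEnv A₁ g)) := Algebra.mem_top
    rwa [← this] at hu
  have h2 : ∀ w : CurrentEnv A₂ g, (1 : CurrentEnv A₁ g) ⊗ₜ[ℂ] w ∈
      (currentProdHom A₁ A₂ g).range := by
    have : (currentProdHom A₁ A₂ g).range.comap
        (Algebra.TensorProduct.includeRight : CurrentEnv A₂ g →ₐ[ℂ]
          CurrentEnv A₁ g ⊗[ℂ] CurrentEnv A₂ g) = ⊤ :=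
      subalgebra_eq_top_of_current_mem _ fun x P =>
        ⟨current x (0, P), by
          refine (currentProdHom_current x _).trans ?_
          rw [current_zero_right, TensorProduct.zero_tmul, zero_add]; rfl⟩
    intro u
    have hu : u ∈ (⊤ : Subalgebra ℂ (CurrentEnv A₂ g)) := Algebra.mem_top
    rwa [← this] at hu
  rw [← AlgHom.range_eq_top, eq_top_iff]
  intro t _
  induction t using TensorProduct.induction_on with
  | zero => exact zero_mem _
  | add a c ha hc => exact add_mem (ha trivial) (hc trivial)
  | tmul u w =>
    have := mul_mem (h1 u) (h2 w)
    rwa [Algebra.TensorProduct.tmul_mul_tmul, one_mul, mul_one] at this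

/-- The tensor product of representations of `g ⊗ A₁` and `g ⊗ A₂`. -/
def prodRep {V₁ V₂ : Type*} [AddCommGroup V₁] [Module ℂ V₁] [AddCommGroup V₂] [Module ℂ V₂]
    (ρ₁ : CurrentEnv A₁ g →ₐ[ℂ] End ℂ V₁) (ρ₂ : CurrentEnv A₂ g →ₐ[ℂ] End ℂ V₂) :
    CurrentEnv (A₁ × A₂) g →ₐ[ℂ] End ℂ (V₁ ⊗[ℂ] V₂) :=
  ((Module.endTensorEndAlgHom (R := ℂ) (S := ℂ) (A := ℂ) (M := V₁) (N := V₂)).comp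
    (Algebra.TensorProduct.map ρ₁ ρ₂)).comp (currentProdHom A₁ A₂ g)

lemma prodRep_current_tmul {V₁ V₂ : Type*} [AddCommGroup V₁] [Module ℂ V₁] [AddCommGroup V₂]
    [Module ℂ V₂] (ρ₁ : CurrentEnv A₁ g →ₐ[ℂ] End ℂ V₁) (ρ₂ : CurrentEnv A₂ g →ₐ[ℂ] End ℂ V₂)
    (x : g) (P : A₁ × A₂) (v : V₁) (w : V₂) :
    prodRep ρ₁ ρ₂ (current x P) (v ⊗ₜ w) =
      ρ₁ (current x P.1) v ⊗ₜ w + v ⊗ₜ ρ₂ (current x P.2) w := by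
  simp only [prodRep, AlgHom.comp_apply, currentProdHom_current, map_add,
    Algebra.TensorProduct.map_tmul, map_one, LinearMap.add_apply, Module.endTensorEndAlgHom_apply]
  simp

lemma prodRep_quotRep_apply (I₁ : Submodule (CurrentEnv A₁ g) (CurrentEnv A₁ g))
    (I₂ : Submodule (CurrentEnv A₂ g) (CurrentEnv A₂ g)) (u : CurrentEnv (A₁ × A₂) g) :
    prodRep (quotRep I₁) (quotRep I₂) u
        (Submodule.Quotient.mk 1 ⊗ₜ Submodule.Quotient.mk 1) =
      TensorProduct.map (quotMk I₁) (quotMk I₂) (currentProdHom A₁ A₂ g u) := by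
  rw [prodRep, AlgHom.comp_apply]
  generalize currentProdHom A₁ A₂ g u = t
  induction t using TensorProduct.induction_on with
  | zero => simp
  | add a c ha hc => rw [map_add, map_add, LinearMap.add_apply, ha, hc]
  | tmul a c =>
    rw [AlgHom.comp_apply, Algebra.TensorProduct.map_tmul, Module.endTensorEndAlgHom_apply]
    change (quotRep I₁ a (Submodule.Quotient.mk 1)) ⊗ₜ (quotRep I₂ c (Submodule.Quotient.mk 1)) = _
    rw [quotRep_mk_one, quotRep_mk_one]
    rfl

/-- The ideals are only left ideals, so the factor known to lie in the ideal must stand on the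
right; both orders are needed. -/
lemma currentProdInv_tmul' (u : CurrentEnv A₁ g) (w : CurrentEnv A₂ g) :
    currentProdInv A₁ A₂ g (u ⊗ₜ w) =
      currentMap (NonUnitalAlgHom.inr ℂ A₁ A₂) w * currentMap (NonUnitalAlgHom.inl ℂ A₁ A₂) u := by
  have h : (u ⊗ₜ[ℂ] w : CurrentEnv A₁ g ⊗[ℂ] CurrentEnv A₂ g) = (1 ⊗ₜ w) * (u ⊗ₜ 1) := by
    rw [Algebra.TensorProduct.tmul_mul_tmul, one_mul, mul_one]
  rw [h, map_mul, currentProdInv_tmul, currentProdInv_tmul, map_one, map_one, one_mul, mul_one]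

variable [FiniteDimensional ℂ g] [IsSemisimple ℂ g]
variable {H : LieSubalgebra ℂ g} [H.IsCartanSubalgebra] {b : (rootSystem H).Base}

/-- The functionals on a product of algebras that are given by functionals on the factors. -/
def prodChar (χ₁ : b.support → A₁ →ₗ[ℂ] ℂ) (χ₂ : b.support → A₂ →ₗ[ℂ] ℂ) (i : b.support) :
    A₁ × A₂ →ₗ[ℂ] ℂ :=
  (χ₁ i).coprod (χ₂ i)

lemma isWeylVector_prodRep {χ₁ : b.support → A₁ →ₗ[ℂ] ℂ} {χ₂ : b.support → A₂ →ₗ[ℂ] ℂ}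
    {I₁ : Submodule (CurrentEnv A₁ g) (CurrentEnv A₁ g)}
    {I₂ : Submodule (CurrentEnv A₂ g) (CurrentEnv A₂ g)}
    (h₁ : IsWeylQuotient b χ₁ I₁) (h₂ : IsWeylQuotient b χ₂ I₂) :
    IsWeylVector b (prodChar χ₁ χ₂) (prodRep (quotRep I₁) (quotRep I₂))
      (Submodule.Quotient.mk 1 ⊗ₜ Submodule.Quotient.mk 1) := by
  refine ⟨fun x hx P => ?_, fun i P => ?_, ?_⟩
  · rw [prodRep_current_tmul, h₁.nPlus_apply x hx, h₂.nPlus_apply x hx, TensorProduct.zero_tmul,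
      TensorProduct.tmul_zero, add_zero]
  · rw [prodRep_current_tmul, h₁.coroot_apply, h₂.coroot_apply, TensorProduct.tmul_smul,
      ← TensorProduct.smul_tmul', ← add_smul]
    rfl
  · classical
    obtain ⟨D₁, hD₁, hv₁⟩ := h₁.integrable
    obtain ⟨D₂, hD₂, hv₂⟩ := h₂.integrable
    refine ⟨Finset.image₂ (· + ·) D₁ D₂, ?_, fun u => ?_⟩
    · intro ν hν
      obtain ⟨μ₁, hμ₁, μ₂, hμ₂, rfl⟩ := Finset.mem_image₂.mp (Finset.mem_coe.mp hν)
      exact add_mem_weightLattice (hD₁ hμ₁) (hD₂ hμ₂)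
    · generalize prodRep (quotRep I₁) (quotRep I₂) u _ = t
      induction t using TensorProduct.induction_on with
      | zero => exact zero_mem _
      | add a c ha hc => exact add_mem ha hc
      | tmul v w =>
        obtain ⟨u₁, rfl⟩ := Submodule.Quotient.mk_surjective I₁ v
        obtain ⟨u₂, rfl⟩ := Submodule.Quotient.mk_surjective I₂ w
        have hu₁ := hv₁ u₁
        have hu₂ := hv₂ u₂
        rw [quotRep_mk_one] at hu₁ hu₂
        obtain ⟨w₁, hw₁, hs₁⟩ := (mem_biSup_iff_exists_sum _ _ _).mp hu₁
        obtain ⟨w₂, hw₂, hs₂⟩ := (mem_biSup_iff_exists_sum _ _ _).mp hu₂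
        rw [← hs₁, ← hs₂, TensorProduct.sum_tmul]
        refine Submodule.sum_mem _ fun μ₁ hμ₁ => ?_
        rw [TensorProduct.tmul_sum]
        refine Submodule.sum_mem _ fun μ₂ hμ₂ => ?_
        refine Submodule.mem_iSup_of_mem (μ₁ + μ₂) (Submodule.mem_iSup_of_mem
          (Finset.mem_image₂_of_mem hμ₁ hμ₂) ?_)
        rw [mem_repWeightSpace]
        intro h
        rw [prodRep_current_tmul, Prod.fst_one, Prod.snd_one,
          mem_repWeightSpace.mp (hw₁ μ₁ hμ₁) h, mem_repWeightSpace.mp (hw₂ μ₂ hμ₂) h,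
          TensorProduct.tmul_smul, ← TensorProduct.smul_tmul', ← add_smul]
        rfl

/-- The local Weyl module over a product of algebras is the tensor product of local Weyl modules
over the factors. -/
theorem nonempty_weylQuotient_prod_equiv (χ₁ : b.support → A₁ →ₗ[ℂ] ℂ)
    (χ₂ : b.support → A₂ →ₗ[ℂ] ℂ) (hχ₁ : ∀ i, ∃ n : ℤ, χ₁ i 1 = n)
    (hχ₂ : ∀ i, ∃ n : ℤ, χ₂ i 1 = n) :
    Nonempty ((CurrentEnv (A₁ × A₂) g ⧸ weylIdeal b (prodChar χ₁ χ₂)) ≃ₗ[ℂ]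
      (CurrentEnv A₁ g ⧸ weylIdeal b χ₁) ⊗[ℂ] (CurrentEnv A₂ g ⧸ weylIdeal b χ₂)) := by
  refine nonempty_quotient_equiv_tensor _ _ _ (currentProdHom A₁ A₂ g).toLinearMap
    currentProdHom_surjective fun u => ⟨fun hu => ?_, fun hu => ?_⟩
  · rw [mem_weylIdeal]
    intro I hI
    rw [← currentProdInv_currentProdHom u]
    -- The generator of any Weyl quotient over the product remains a Weyl vector over each factor,
    -- so both Weyl ideals of the factors map into `I`.
    refine mem_of_map_quotMk_eq_zero (currentProdInv A₁ A₂ g).toLinearMap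
      (fun a ha c => ?_) (fun c hc a => ?_) hu
    · rw [AlgHom.toLinearMap_apply, currentProdInv_tmul']
      exact I.smul_mem _ (hI.currentMap_mem (NonUnitalAlgHom.inl ℂ A₁ A₂) (0, 1) (by simp)
        (by simp) (fun i => by simpa [prodChar] using hχ₂ i) (fun i P => by simp [prodChar]) ha)
    · rw [AlgHom.toLinearMap_apply, currentProdInv_tmul]
      exact I.smul_mem _ (hI.currentMap_mem (NonUnitalAlgHom.inr ℂ A₁ A₂) (1, 0) (by simp)
        (by simp) (fun i => by simpa [prodChar] using hχ₁ i) (fun i P => by simp [prodChar]) hc)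
  -- Conversely, Weyl quotients of the two factors tensor to a module over the product with Weyl
  -- vector 1 ⊗ 1.
  · refine map_quotMk_sInf_eq_zero fun I₁ hI₁ I₂ hI₂ => ?_
    rw [AlgHom.toLinearMap_apply, ← prodRep_quotRep_apply]
    exact (isWeylVector_prodRep hI₁ hI₂).apply_eq_zero hu

end Product

/-! ### Jets at a regular point. -/

section RegularLocal

open IsLocalRing MvPolynomial

lemma exists_span_range_eq_maximalIdeal {R : Type*} [CommRing R] [IsRegularLocalRing R] {d : ℕ}
    (hd : ringKrullDim R = d) : ∃ t : Fin d → R, Ideal.span (Set.range t) = maximalIdeal R := by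
  obtain ⟨s, hs, hspan⟩ := Submodule.FG.exists_span_finset_card_eq_spanFinrank
    (IsNoetherian.noetherian (maximalIdeal R))
  have hcard : s.card = d := by
    have h := IsRegularLocalRing.spanFinrank_maximalIdeal (R := R)
    rw [hd, ← hs] at h
    exact_mod_cast h
  subst hcard
  refine ⟨fun i => (s.equivFin.symm i : R), ?_⟩
  rw [← hspan, Ideal.span, Set.range_comp' Subtype.val s.equivFin.symm, Equiv.range_eq_univ,
    Set.image_univ, Subtype.range_coe]

variable {R : Type*} [CommRing R] [Algebra ℂ R]

lemma aeval_mul_of_isHomogeneous {d n : ℕ} {F : MvPolynomial (Fin d) ℂ} (hF : F.IsHomogeneous n)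
    (a : Fin d → ℂ) (s : R) :
    aeval (fun j => algebraMap ℂ R (a j) * s) F = algebraMap ℂ R (eval a F) * s ^ n := by
  rw [aeval_def, eval₂_eq', eval_eq', map_sum, Finset.sum_mul]
  refine Finset.sum_congr rfl fun x hx => ?_
  have hdeg : ∑ i, x i = n := by
    have h := hF (mem_support_iff.mp hx)
    rw [← h, Finsupp.weight_apply, Finsupp.sum_fintype _ _ (by simp)]
    simp
  simp only [mul_pow, Finset.prod_mul_distrib, Finset.prod_pow_eq_pow_sum, hdeg, map_mul, map_prod,
    map_pow]
  ring

lemma aeval_sub_aeval_mem {d : ℕ} (q : Ideal R) (t t' : Fin d → R) (h : ∀ j, t j - t' j ∈ q)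
    (F : MvPolynomial (Fin d) ℂ) : aeval t F - aeval t' F ∈ q := by
  rw [← Ideal.Quotient.mk_eq_mk_iff_sub_mem]
  have : (Ideal.Quotient.mkₐ ℂ q).comp (aeval t) = (Ideal.Quotient.mkₐ ℂ q).comp (aeval t') := by
    ext j
    simpa using (Ideal.Quotient.mk_eq_mk_iff_sub_mem _ _).mpr (h j)
  exact DFunLike.congr_fun this F

lemma aeval_mem_pow {d n : ℕ} (m : Ideal R) (t : Fin d → R) (h : ∀ j, t j ∈ m)
    {G : MvPolynomial (Fin d) ℂ} (hG : G ∈ idealOfVars (Fin d) ℂ ^ n) : aeval t G ∈ m ^ n := by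
  have hle : (idealOfVars (Fin d) ℂ).map (aeval t : MvPolynomial (Fin d) ℂ →ₐ[ℂ] R) ≤ m := by
    rw [idealOfVars, Ideal.map_span, Ideal.span_le]
    rintro _ ⟨_, ⟨j, rfl⟩, rfl⟩
    simpa using h j
  have := Ideal.mem_map_of_mem (aeval t : MvPolynomial (Fin d) ℂ →ₐ[ℂ] R) hG
  rw [Ideal.map_pow] at this
  exact Ideal.pow_right_mono hle n this

lemma algebraMap_notMem_maximalIdeal [IsLocalRing R] {c : ℂ} (hc : c ≠ 0) :
    algebraMap ℂ R c ∉ maximalIdeal R := by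
  rw [IsLocalRing.mem_maximalIdeal, mem_nonunits_iff, not_not]
  exact (IsUnit.mk0 c hc).map (algebraMap ℂ R)

lemma sup_pow_le_sup_pow {S : Type*} [CommRing S] (I J : Ideal S) (n : ℕ) :
    (I ⊔ J) ^ n ≤ I ⊔ J ^ n := by
  induction n with
  | zero => simp
  | succ n ih =>
    rw [pow_succ]
    refine (Ideal.mul_mono_left ih).trans ?_
    rw [Ideal.sup_mul, pow_succ]
    have h1 : I * (I ⊔ J) ≤ I := Ideal.mul_le_left
    have h2 : J ^ n * I ≤ I := Ideal.mul_le_right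
    rw [Ideal.mul_sup (J ^ n)]
    exact sup_le (h1.trans le_sup_left) (sup_le (h2.trans le_sup_left) le_sup_right)

/-- A regular system of parameters satisfies no homogeneous relation in the associated graded
ring. -/
lemma eq_zero_of_aeval_mem_pow_succ [IsLocalRing R] [IsNoetherianRing R] {d : ℕ}
    (hd : ringKrullDim R = d) {t : Fin d → R} (ht : Ideal.span (Set.range t) = maximalIdeal R)
    {n : ℕ} {F : MvPolynomial (Fin d) ℂ} (hF : F.IsHomogeneous n)
    (hFt : aeval t F ∈ maximalIdeal R ^ (n + 1)) : F = 0 := by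
  classical
  by_contra hF0
  obtain ⟨c, hc⟩ : ∃ c, eval c F ≠ 0 := by
    by_contra! hcon
    exact hF0 (MvPolynomial.funext fun c => by rw [hcon, map_zero])
  have htm : ∀ j, t j ∈ maximalIdeal R := fun j => ht ▸ Ideal.subset_span ⟨j, rfl⟩
  -- If `c = 0`, then F(t) is congruent modulo the maximal ideal to the unit F(0), yet lies in that
  -- ideal. Otherwise some coordinate of `c` can be inverted.
  by_cases hc0 : c = 0
  · subst hc0
    have h1 := aeval_sub_aeval_mem (maximalIdeal R) t 0 (by simpa using htm) F
    have h2 : aeval (0 : Fin d → R) F = algebraMap ℂ R (eval 0 F) := by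
      simp [constantCoeff_eq, aeval_zero, eval_zero]
    rw [h2] at h1
    have h3 := sub_mem (Ideal.pow_le_self (Nat.succ_ne_zero n) hFt) h1
    rw [sub_sub_cancel] at h3
    exact algebraMap_notMem_maximalIdeal hc h3
  · obtain ⟨k, hk⟩ : ∃ k, c k ≠ 0 := Function.ne_iff.mp hc0
    -- These are the equations of the line through `c`. As `u k = 0`, only d - 1 of them are needed
    -- to generate `q`.
    let u : Fin d → R := fun j => t j - algebraMap ℂ R (c j) * (algebraMap ℂ R (c k)⁻¹ * t k)
    let s : Finset R := (Finset.univ.erase k).image u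
    let q : Ideal R := Ideal.span (s : Set R)
    have hkk : algebraMap ℂ R (c k) * (algebraMap ℂ R (c k)⁻¹ * t k) = t k := by
      rw [← mul_assoc, ← map_mul, mul_inv_cancel₀ hk, map_one, one_mul]
    have huq : ∀ j, u j ∈ q := by
      intro j
      by_cases hj : j = k
      · subst hj
        simp only [u, hkk, sub_self, zero_mem]
      · exact Ideal.subset_span (Finset.mem_coe.mpr (Finset.mem_image_of_mem _
          (Finset.mem_erase.mpr ⟨hj, Finset.mem_univ j⟩)))
    have hum : ∀ j, u j ∈ maximalIdeal R := fun j =>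
      sub_mem (htm j) (Ideal.mul_mem_left _ _ (Ideal.mul_mem_left _ _ (htm k)))
    have hqm : q ≤ maximalIdeal R := by
      rw [Ideal.span_le]
      intro x hx
      obtain ⟨j, -, rfl⟩ := Finset.mem_image.mp (Finset.mem_coe.mp hx)
      exact hum j
    have hmq : maximalIdeal R ≤ q ⊔ Ideal.span {t k} := by
      rw [← ht, Ideal.span_le]
      rintro _ ⟨j, rfl⟩
      have h1 : t j = u j + algebraMap ℂ R (c j) * (algebraMap ℂ R (c k)⁻¹ * t k) := by
        simp only [u, sub_add_cancel]
      rw [h1]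
      exact add_mem (Ideal.mem_sup_left (huq j)) (Ideal.mem_sup_right (Ideal.mul_mem_left _ _
        (Ideal.mul_mem_left _ _ (Ideal.mem_span_singleton_self _))))
    -- Modulo `q`, the system `t` is `c` scaled by t_k / c_k, so F(t) becomes F(c) c_k^(-n) t_k^n
    -- with an invertible coefficient.
    have htk : t k ^ n ∈ q ⊔ maximalIdeal R ^ (n + 1) := by
      have h1 := aeval_sub_aeval_mem q t
        (fun j => algebraMap ℂ R (c j) * (algebraMap ℂ R (c k)⁻¹ * t k)) huq F
      rw [aeval_mul_of_isHomogeneous hF, mul_pow, ← mul_assoc, ← map_pow, ← map_mul] at h1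
      have h2 := sub_mem (Ideal.mem_sup_right (S := q) hFt)
        (Ideal.mem_sup_left (T := maximalIdeal R ^ (n + 1)) h1)
      rw [sub_sub_cancel] at h2
      have h3 := Ideal.mul_mem_left _ (algebraMap ℂ R (eval c F * (c k)⁻¹ ^ n)⁻¹) h2
      rwa [← mul_assoc, ← map_mul, inv_mul_cancel₀ (mul_ne_zero hc (pow_ne_zero _
        (inv_ne_zero hk))), map_one, one_mul] at h3
    -- The maximal ideal m is contained in q + (t_k), so m^n ≤ q + m^(n+1), and Nakayama's lemma
    -- removes the last term. Then m is minimal over d - 1 elements, against Krull's height theorem.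
    have hpow : maximalIdeal R ^ n ≤ q := by
      refine Submodule.le_of_le_smul_of_le_jacobson_bot (I := maximalIdeal R)
        (IsNoetherian.noetherian _) (IsLocalRing.maximalIdeal_le_jacobson ⊥) ?_
      rw [smul_eq_mul, ← pow_succ']
      calc maximalIdeal R ^ n ≤ (q ⊔ Ideal.span {t k}) ^ n := Ideal.pow_right_mono hmq n
        _ ≤ q ⊔ Ideal.span {t k} ^ n := sup_pow_le_sup_pow _ _ n
        _ ≤ q ⊔ maximalIdeal R ^ (n + 1) := by
          refine sup_le le_sup_left ?_
          rwa [Ideal.span_singleton_pow, Ideal.span_singleton_le_iff_mem]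
    have hmin : maximalIdeal R ∈ q.minimalPrimes := by
      refine ⟨⟨inferInstance, hqm⟩, fun p hp _ => ?_⟩
      exact hp.1.le_of_pow_le (hpow.trans hp.2)
    have hheight := Ideal.height_le_card_of_mem_minimalPrimes_span_finset hmin
    have hcard : s.card ≤ d - 1 := by
      refine Finset.card_image_le.trans ?_
      rw [Finset.card_erase_of_mem (Finset.mem_univ k), Finset.card_univ, Fintype.card_fin]
    have hdim := IsLocalRing.maximalIdeal_height_eq_ringKrullDim (R := R)
    rw [hd] at hdim
    have hd' : (maximalIdeal R).height = d := by exact_mod_cast hdim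
    rw [hd', Nat.cast_le] at hheight
    have := k.pos
    omega

/-- The kernel of the map from polynomials to jets at a regular point. -/
lemma mem_pow_idealOfVars_of_aeval_mem [IsLocalRing R] [IsNoetherianRing R] {d : ℕ}
    (hd : ringKrullDim R = d) {t : Fin d → R} (ht : Ideal.span (Set.range t) = maximalIdeal R)
    {N : ℕ} {G : MvPolynomial (Fin d) ℂ} (hG : aeval t G ∈ maximalIdeal R ^ N) :
    G ∈ idealOfVars (Fin d) ℂ ^ N := by
  have htm : ∀ j, t j ∈ maximalIdeal R := fun j => ht ▸ Ideal.subset_span ⟨j, rfl⟩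
  suffices h : ∀ n ≤ N, G ∈ idealOfVars (Fin d) ℂ ^ n from h N le_rfl
  intro n
  induction n with
  | zero => intro _; simp
  | succ n ih =>
    intro hn
    have h1 := ih (by omega)
    have h2 : G - homogeneousComponent n G ∈ idealOfVars (Fin d) ℂ ^ (n + 1) := by
      rw [mem_pow_idealOfVars_iff'] at h1 ⊢
      intro x hx
      rw [coeff_sub, coeff_homogeneousComponent]
      split_ifs with hxn
      · rw [sub_self]
      · rw [sub_zero, h1 x (by omega)]
    -- Once the lower terms are gone, the component of degree n takes a value in the (n+1)-st power
    -- of the maximal ideal, so it is a forbidden relation.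
    have h3 : homogeneousComponent n G = 0 := by
      refine eq_zero_of_aeval_mem_pow_succ hd ht (homogeneousComponent_isHomogeneous n G) ?_
      have h4 := sub_mem (Ideal.pow_le_pow_right hn hG) (aeval_mem_pow _ t htm h2)
      rwa [map_sub, sub_sub_cancel] at h4
    rwa [h3, sub_zero] at h2

/-- Successive approximation: write r - c = ∑ a_j t_j with c a constant; approximating the a_j
modulo m^N approximates r modulo m^(N+1). -/
lemma exists_sub_aeval_mem_pow {m : Ideal R} (hm : ∀ r : R, ∃ c : ℂ, r - algebraMap ℂ R c ∈ m)
    {d : ℕ} {t : Fin d → R} (ht : Ideal.span (Set.range t) = m) (N : ℕ) (r : R) :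
    ∃ G : MvPolynomial (Fin d) ℂ, r - aeval t G ∈ m ^ N := by
  induction N generalizing r with
  | zero => exact ⟨0, by simp⟩
  | succ N ih =>
    obtain ⟨c, hc⟩ := hm r
    rw [← ht, Ideal.mem_span_range_iff_exists_fun] at hc
    obtain ⟨a, ha⟩ := hc
    choose G hG using fun j => ih (a j)
    refine ⟨C c + ∑ j, G j * X j, ?_⟩
    have : r - aeval t (C c + ∑ j, G j * X j) = ∑ j, (a j - aeval t (G j)) * t j := by
      simp only [map_add, map_sum, map_mul, aeval_X, sub_mul, Finset.sum_sub_distrib, ha]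
      rw [← algebraMap_eq, AlgHom.commutes]
      ring
    rw [this, pow_succ]
    exact sum_mem fun j _ => Ideal.mul_mem_mul (hG j) (ht ▸ Ideal.subset_span ⟨j, rfl⟩)

end RegularLocal

/-! ### Comparison of A/p^N with its local counterpart. -/

section Localization

open IsLocalRing

variable {A : Type*} [CommRing A] (p : Ideal A) [p.IsMaximal]

lemma exists_mul_sub_one_mem_pow {s : A} (hs : s ∉ p) (N : ℕ) : ∃ u, s * u - 1 ∈ p ^ N := by
  have h : Ideal.span {s} ⊔ p = ⊤ := by
    obtain ⟨y, i, hi, h⟩ := Ideal.IsMaximal.exists_inv ‹_› hs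
    rw [Ideal.eq_top_iff_one, ← h]
    exact add_mem (Ideal.mem_sup_left (Ideal.mul_mem_left _ _ (Ideal.mem_span_singleton_self s)))
      (Ideal.mem_sup_right hi)
  have h1 := Ideal.sup_pow_eq_top (n := N) h
  rw [Ideal.eq_top_iff_one, Submodule.mem_sup] at h1
  obtain ⟨x, hx, y, hy, hxy⟩ := h1
  obtain ⟨u, rfl⟩ := Ideal.mem_span_singleton'.mp hx
  refine ⟨u, ?_⟩
  rw [← hxy, mul_comm s u, sub_add_cancel_left]
  exact neg_mem hy

/-- Injectivity of A/p^N → A_p/m^N: a denominator is invertible modulo p^N and can be cancelled. The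
next lemma is surjectivity, for the same reason. -/
lemma algebraMap_mem_maximalIdeal_pow {N : ℕ} {a : A}
    (ha : algebraMap A (Localization.AtPrime p) a ∈ maximalIdeal (Localization.AtPrime p) ^ N) :
    a ∈ p ^ N := by
  rw [← Localization.AtPrime.map_eq_maximalIdeal, ← Ideal.map_pow,
    IsLocalization.algebraMap_mem_map_algebraMap_iff p.primeCompl] at ha
  obtain ⟨s, hs, hsa⟩ := ha
  obtain ⟨u, hu⟩ := exists_mul_sub_one_mem_pow p hs N
  have h := sub_mem (Ideal.mul_mem_left _ u hsa) (Ideal.mul_mem_left _ a hu)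
  have h' : u * (s * a) - a * (s * u - 1) = a := by ring
  rwa [h'] at h

lemma exists_sub_algebraMap_mem_maximalIdeal_pow (N : ℕ) (r : Localization.AtPrime p) :
    ∃ a : A, r - algebraMap A _ a ∈ maximalIdeal (Localization.AtPrime p) ^ N := by
  obtain ⟨a, s, rfl⟩ := IsLocalization.exists_mk'_eq p.primeCompl r
  obtain ⟨u, hu⟩ := exists_mul_sub_one_mem_pow p s.2 N
  refine ⟨a * u, ?_⟩
  have h := Ideal.mem_map_of_mem (algebraMap A (Localization.AtPrime p)) hu
  rw [Ideal.map_pow, Localization.AtPrime.map_eq_maximalIdeal] at h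
  have h1 := Ideal.mul_mem_left _ (-IsLocalization.mk' (Localization.AtPrime p) a s) h
  have h2 : -IsLocalization.mk' (Localization.AtPrime p) a s *
      algebraMap A (Localization.AtPrime p) (s * u - 1) =
      IsLocalization.mk' (Localization.AtPrime p) a s - algebraMap A _ (a * u) := by
    have h3 := IsLocalization.mk'_spec (Localization.AtPrime p) a s
    rw [map_sub, map_mul, map_mul, map_one, ← h3]
    ring
  rwa [h2] at h1

end Localization

/-! ### Reduction to one point, and the comparison with the origin. -/

section Comparison

variable {A B C g : Type*} [CommRing A] [Algebra ℂ A] [CommRing B] [Algebra ℂ B]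
  [CommRing C] [Algebra ℂ C] [LieRing g] [LieAlgebra ℂ g]

lemma exists_comp_eq_of_surjective {ι : Type*} (π : A →ₐ[ℂ] C) (hπ : Function.Surjective π)
    (χ : ι → A →ₗ[ℂ] ℂ) (h : ∀ P, π P = 0 → ∀ i, χ i P = 0) :
    ∃ χ' : ι → C →ₗ[ℂ] ℂ, ∀ i P, χ' i (π P) = χ i P := by
  obtain ⟨s, hs⟩ := LinearMap.exists_rightInverse_of_surjective π.toLinearMap
    (LinearMap.range_eq_top.mpr hπ)
  refine ⟨fun i => χ i ∘ₗ s, fun i P => ?_⟩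
  rw [LinearMap.comp_apply, ← sub_eq_zero, ← map_sub]
  apply h
  have hs' : π (s (π P)) = π P := LinearMap.congr_fun hs (π P)
  rw [map_sub, hs', sub_self]

lemma nonempty_quotient_equiv_of_eq {U : Type*} [Ring U] [Algebra ℂ U] {I J : Submodule U U}
    (h : I = J) : Nonempty ((U ⧸ I) ≃ₗ[ℂ] U ⧸ J) := by
  subst h
  exact ⟨LinearEquiv.refl ℂ _⟩

variable [FiniteDimensional ℂ g] [IsSemisimple ℂ g]
variable {H : LieSubalgebra ℂ g} [H.IsCartanSubalgebra] {b : (rootSystem H).Base}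

/-- Form of `nonempty_weylQuotient_equiv_of_surjective` with the functionals on `A` given. -/
lemma nonempty_weylQuotient_equiv_of_kills (π : A →ₐ[ℂ] C) (hπ : Function.Surjective π)
    (χ : b.support → A →ₗ[ℂ] ℂ) (χ' : b.support → C →ₗ[ℂ] ℂ) (h : ∀ i P, χ' i (π P) = χ i P)
    (hkill : ∀ I : Submodule (CurrentEnv A g) (CurrentEnv A g), IsWeylQuotient b χ I →
      ∀ (x : g) (P : A), π P = 0 → quotRep I (current x P) = 0) :
    Nonempty ((CurrentEnv A g ⧸ weylIdeal b χ) ≃ₗ[ℂ] CurrentEnv C g ⧸ weylIdeal b χ') := by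
  have hχ : χ = fun i => χ' i ∘ₗ π.toLinearMap :=
    funext fun i => LinearMap.ext fun P => (h i P).symm
  subst hχ
  exact nonempty_weylQuotient_equiv_of_surjective π hπ χ' hkill

/-- Local Weyl modules over algebras with a common quotient `C` agree if the kernels of the
projections to `C` act by zero. -/
lemma nonempty_weylQuotient_equiv_of_common_quotient (π : A →ₐ[ℂ] C)
    (hπ : Function.Surjective π) (π' : B →ₐ[ℂ] C) (hπ' : Function.Surjective π')
    (χ : b.support → A →ₗ[ℂ] ℂ) (χ' : b.support → B →ₗ[ℂ] ℂ)
    (h : ∀ P Q, π P = π' Q → ∀ i, χ i P = χ' i Q)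
    (hkill : ∀ I : Submodule (CurrentEnv A g) (CurrentEnv A g), IsWeylQuotient b χ I →
      ∀ (x : g) (P : A), π P = 0 → quotRep I (current x P) = 0)
    (hkill' : ∀ I : Submodule (CurrentEnv B g) (CurrentEnv B g), IsWeylQuotient b χ' I →
      ∀ (x : g) (P : B), π' P = 0 → quotRep I (current x P) = 0) :
    Nonempty ((CurrentEnv A g ⧸ weylIdeal b χ) ≃ₗ[ℂ] CurrentEnv B g ⧸ weylIdeal b χ') := by
  obtain ⟨ψ, hψ⟩ := exists_comp_eq_of_surjective π hπ χ (fun P hP i => by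
    rw [h P 0 (by rw [hP, map_zero]) i, map_zero])
  have hψ' : ∀ i Q, ψ i (π' Q) = χ' i Q := by
    intro i Q
    obtain ⟨P, hP⟩ := hπ (π' Q)
    rw [← hP, hψ, h P Q hP]
  obtain ⟨e⟩ := nonempty_weylQuotient_equiv_of_kills π hπ χ ψ hψ hkill
  obtain ⟨e'⟩ := nonempty_weylQuotient_equiv_of_kills π' hπ' χ' ψ hψ' hkill'
  exact ⟨e ≪≫ₗ e'.symm⟩

/-- Functionals supported at disjoint closed subsets give a tensor product decomposition. -/
theorem nonempty_weylQuotient_add_equiv [IsNoetherianRing A] (χ₁ χ₂ : b.support → A →ₗ[ℂ] ℂ)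
    (J₁ J₂ : Ideal A) (hJ : J₁ ⊔ J₂ = ⊤) (h₁ : ∀ P ∈ J₁, ∀ i, χ₁ i P = 0)
    (h₂ : ∀ P ∈ J₂, ∀ i, χ₂ i P = 0) (hχ₁ : ∀ i, ∃ n : ℤ, χ₁ i 1 = n)
    (hχ₂ : ∀ i, ∃ n : ℤ, χ₂ i 1 = n) :
    Nonempty ((CurrentEnv A g ⧸ weylIdeal b (χ₁ + χ₂)) ≃ₗ[ℂ]
      (CurrentEnv A g ⧸ weylIdeal b χ₁) ⊗[ℂ] (CurrentEnv A g ⧸ weylIdeal b χ₂)) := by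
  obtain ⟨N₀, hN₀⟩ := exists_pow_annihilates (χ₁ + χ₂) (J₁ ⊓ J₂) (fun P hP i => by
    rw [Pi.add_apply, LinearMap.add_apply, h₁ P hP.1, h₂ P hP.2, add_zero])
  obtain ⟨N₁, hN₁⟩ := exists_pow_annihilates χ₁ J₁ h₁
  obtain ⟨N₂, hN₂⟩ := exists_pow_annihilates χ₂ J₂ h₂
  -- Large enough for all three modules at once, and positive so that the functionals factor through
  -- the quotients.
  let N := N₀ + N₁ + N₂ + 1
  have hN0 : N ≠ 0 := Nat.succ_ne_zero _
  let π₁ : A →ₐ[ℂ] A ⧸ J₁ ^ N := Ideal.Quotient.mkₐ ℂ (J₁ ^ N)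
  let π₂ : A →ₐ[ℂ] A ⧸ J₂ ^ N := Ideal.Quotient.mkₐ ℂ (J₂ ^ N)
  have hπ₁ : Function.Surjective π₁ := Ideal.Quotient.mkₐ_surjective ℂ _
  have hπ₂ : Function.Surjective π₂ := Ideal.Quotient.mkₐ_surjective ℂ _
  have hk₁ : ∀ P, π₁ P = 0 ↔ P ∈ J₁ ^ N := fun P => Ideal.Quotient.eq_zero_iff_mem
  have hk₂ : ∀ P, π₂ P = 0 ↔ P ∈ J₂ ^ N := fun P => Ideal.Quotient.eq_zero_iff_mem
  obtain ⟨ψ₁, hψ₁⟩ := exists_comp_eq_of_surjective π₁ hπ₁ χ₁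
    (fun P hP => h₁ P (Ideal.pow_le_self hN0 ((hk₁ P).mp hP)))
  obtain ⟨ψ₂, hψ₂⟩ := exists_comp_eq_of_surjective π₂ hπ₂ χ₂
    (fun P hP => h₂ P (Ideal.pow_le_self hN0 ((hk₂ P).mp hP)))
  have hcop : J₁ ^ N ⊔ J₂ ^ N = ⊤ := Ideal.pow_sup_pow_eq_top hJ
  -- For coprime ideals the intersection is the product. Hence the kernel of the map to the product
  -- of quotients acts by zero on all Weyl quotients for `χ₁ + χ₂`.
  have hinf : J₁ ^ N ⊓ J₂ ^ N ≤ (J₁ ⊓ J₂) ^ N := by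
    rw [← Ideal.mul_eq_inf_of_isCoprime (Ideal.isCoprime_iff_sup_eq.mpr hcop), ← mul_pow]
    exact Ideal.pow_right_mono Ideal.mul_le_inf N
  have hsurj : Function.Surjective (π₁.prod π₂) := by
    rintro ⟨y₁, y₂⟩
    obtain ⟨a, rfl⟩ := hπ₁ y₁
    obtain ⟨c, rfl⟩ := hπ₂ y₂
    obtain ⟨x, hx, y, hy, hxy⟩ := Submodule.mem_sup.mp ((Ideal.eq_top_iff_one _).mp hcop)
    refine ⟨a * y + c * x, Prod.ext ?_ ?_⟩
    · change π₁ (a * y + c * x) = π₁ a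
      rw [← sub_eq_zero, ← map_sub, hk₁]
      have : a * y + c * x - a = (c - a) * x := by linear_combination a * hxy
      rw [this]
      exact Ideal.mul_mem_left _ _ hx
    · change π₂ (a * y + c * x) = π₂ c
      rw [← sub_eq_zero, ← map_sub, hk₂]
      have : a * y + c * x - c = (a - c) * y := by linear_combination c * hxy
      rw [this]
      exact Ideal.mul_mem_left _ _ hy
  obtain ⟨e⟩ := nonempty_weylQuotient_equiv_of_kills (π₁.prod π₂) hsurj (χ₁ + χ₂)
    (prodChar ψ₁ ψ₂) (fun i P => by
      change ψ₁ i (π₁ P) + ψ₂ i (π₂ P) = χ₁ i P + χ₂ i P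
      rw [hψ₁, hψ₂]) (fun I hI x P hP => hN₀ N (by omega) I hI x P (hinf
        ⟨(hk₁ P).mp (congrArg Prod.fst hP), (hk₂ P).mp (congrArg Prod.snd hP)⟩))
  obtain ⟨e₁⟩ := nonempty_weylQuotient_equiv_of_kills π₁ hπ₁ χ₁ ψ₁ hψ₁
    (fun I hI x P hP => hN₁ N (by omega) I hI x P ((hk₁ P).mp hP))
  obtain ⟨e₂⟩ := nonempty_weylQuotient_equiv_of_kills π₂ hπ₂ χ₂ ψ₂ hψ₂
    (fun I hI x P hP => hN₂ N (by omega) I hI x P ((hk₂ P).mp hP))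
  obtain ⟨e'⟩ := nonempty_weylQuotient_prod_equiv (g := g) ψ₁ ψ₂
    (fun i => by rw [← map_one π₁, hψ₁]; exact hχ₁ i)
    (fun i => by rw [← map_one π₂, hψ₂]; exact hχ₂ i)
  exact ⟨e ≪≫ₗ e' ≪≫ₗ TensorProduct.congr e₁.symm e₂.symm⟩

/-- The functionals of the family in which each point `z` occurs `n i` times in the component
`i`. -/
def pointChar (n : DominantWeight b) (z : A →ₐ[ℂ] ℂ) (i : b.support) : A →ₗ[ℂ] ℂ :=
  n i • z.toLinearMap

lemma familyChar_const (n : DominantWeight b) (z : A →ₐ[ℂ] ℂ) :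
    familyChar (lam := n) (fun _ _ => z) = pointChar n z := by
  funext i
  simp [familyChar, pointChar]

lemma exists_familyChar_eq_sum {lam : DominantWeight b} (Z : PointFamily A lam) :
    ∃ (S : Finset (A →ₐ[ℂ] ℂ)) (n : (A →ₐ[ℂ] ℂ) → DominantWeight b),
      familyChar Z = ∑ z ∈ S, pointChar (n z) z := by
  classical
  refine ⟨Finset.univ.image fun p : (i : b.support) × Fin (lam i) => Z p.1 p.2,
    fun z i => (Finset.univ.filter fun j => Z i j = z).card, ?_⟩
  funext i
  rw [familyChar, Finset.sum_comp (fun z : A →ₐ[ℂ] ℂ => z.toLinearMap) (Z i), Finset.sum_apply]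
  refine Finset.sum_subset (fun z hz => ?_) fun z _ hz => ?_
  · obtain ⟨j, -, rfl⟩ := Finset.mem_image.mp hz
    exact Finset.mem_image.mpr ⟨⟨i, j⟩, Finset.mem_univ _, rfl⟩
  · rw [Finset.filter_false_of_mem, Finset.card_empty, zero_smul]
    exact fun j _ hj => hz (Finset.mem_image.mpr ⟨j, Finset.mem_univ j, hj⟩)

/-- If P separates the points, P - z(P) and P - w(P) differ by a nonzero scalar. -/
lemma ker_sup_ker_eq_top {z w : A →ₐ[ℂ] ℂ} (h : z ≠ w) :
    RingHom.ker z ⊔ RingHom.ker w = ⊤ := by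
  obtain ⟨P, hP⟩ : ∃ P, z P ≠ w P := by
    by_contra! hcon
    exact h (AlgHom.ext hcon)
  have h1 : P - algebraMap ℂ A (z P) ∈ RingHom.ker z := by
    rw [RingHom.mem_ker, map_sub, AlgHom.commutes]
    exact sub_self _
  have h2 : P - algebraMap ℂ A (w P) ∈ RingHom.ker w := by
    rw [RingHom.mem_ker, map_sub, AlgHom.commutes]
    exact sub_self _
  have h3 := sub_mem (Ideal.mem_sup_left (T := RingHom.ker w) h1)
    (Ideal.mem_sup_right (S := RingHom.ker z) h2)
  rw [sub_sub_sub_cancel_left, ← map_sub] at h3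
  have h4 := Ideal.mul_mem_left _ (algebraMap ℂ A (w P - z P)⁻¹) h3
  rw [← map_mul, inv_mul_cancel₀ (sub_ne_zero.mpr hP.symm), map_one] at h4
  exact (Ideal.eq_top_iff_one _).mpr h4

/-- The local Weyl module at a single regular point. -/
theorem nonempty_pointWeyl_equiv [IsNoetherianRing A] {d : ℕ} (hA : IsNonsingularOfDim A d)
    (n : DominantWeight b) (z : A →ₐ[ℂ] ℂ) :
    Nonempty ((CurrentEnv A g ⧸ weylIdeal b (pointChar n z)) ≃ₗ[ℂ]
      CurrentEnv (MvPolynomial (Fin d) ℂ) g ⧸ weylIdeal b (pointChar n (originPoint d))) := by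
  have hz : Function.Surjective z := fun c => ⟨algebraMap ℂ A c, z.commutes c⟩
  let p : Ideal A := RingHom.ker z
  have : p.IsMaximal := RingHom.ker_isMaximal_of_surjective z hz
  obtain ⟨hreg, hdim⟩ := hA p
  let R := Localization.AtPrime p
  let m := IsLocalRing.maximalIdeal R
  obtain ⟨t, ht⟩ : ∃ t : Fin d → R, Ideal.span (Set.range t) = m :=
    exists_span_range_eq_maximalIdeal hdim
  have htm : ∀ j, t j ∈ m := fun j => ht ▸ Ideal.subset_span ⟨j, rfl⟩
  have hpm : ∀ P ∈ p, algebraMap A R P ∈ m := fun P hP =>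
    (IsLocalization.AtPrime.to_map_mem_maximal_iff R p P).mpr hP
  have hzm : ∀ P, algebraMap A R P - algebraMap ℂ R (z P) ∈ m := by
    intro P
    rw [IsScalarTower.algebraMap_apply ℂ A R, ← map_sub]
    apply hpm
    change z _ = 0
    rw [map_sub, AlgHom.commutes]
    exact sub_self _
  have hres : ∀ r : R, ∃ c : ℂ, r - algebraMap ℂ R c ∈ m := by
    intro r
    obtain ⟨a, ha⟩ := exists_sub_algebraMap_mem_maximalIdeal_pow p 1 r
    rw [pow_one] at ha
    have h := add_mem ha (hzm a)
    exact ⟨z a, by rwa [sub_add_sub_cancel] at h⟩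
  have horigin : ∀ G, MvPolynomial.aeval t G - algebraMap ℂ R (originPoint d G) ∈ m := by
    intro G
    have h1 := aeval_sub_aeval_mem m t 0 (by simpa using htm) G
    have h2 : MvPolynomial.aeval (0 : Fin d → R) G = algebraMap ℂ R (originPoint d G) := by
      simp [originPoint, MvPolynomial.aeval_zero]
    rwa [h2] at h1
  obtain ⟨N₁, hN₁⟩ := exists_pow_annihilates (g := g) (pointChar n z) p (fun P hP i => by
    have : z P = 0 := hP
    simp [pointChar, this])
  obtain ⟨N₂, hN₂⟩ := exists_pow_annihilates (g := g) (pointChar n (originPoint d))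
    (MvPolynomial.idealOfVars (Fin d) ℂ) (fun P hP i => by
      have hle : MvPolynomial.idealOfVars (Fin d) ℂ ≤ RingHom.ker (originPoint d) := by
        rw [MvPolynomial.idealOfVars, Ideal.span_le]
        rintro _ ⟨j, rfl⟩
        simp [originPoint]
      have : originPoint d P = 0 := hle hP
      simp [pointChar, this])
  let N := N₁ + N₂ + 1
  let q : R →ₐ[ℂ] R ⧸ m ^ N := Ideal.Quotient.mkₐ ℂ (m ^ N)
  have hq : ∀ r s, q r = q s ↔ r - s ∈ m ^ N := fun r s =>
    Ideal.Quotient.mk_eq_mk_iff_sub_mem r s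
  have hqs : Function.Surjective q := Ideal.Quotient.mkₐ_surjective ℂ _
  -- The common quotient is the ring R/m^N of jets, reached from `A` by localizing and from
  -- polynomials by substituting the parameters `t`. The remaining goals are surjectivity of both
  -- maps, equality of the two evaluations on elements with the same jet, and vanishing of the
  -- action of both kernels.
  refine nonempty_weylQuotient_equiv_of_common_quotient
    (q.comp (IsScalarTower.toAlgHom ℂ A R)) ?_ (q.comp (MvPolynomial.aeval t)) ?_ _ _ ?_ ?_ ?_
  · intro y
    obtain ⟨r, rfl⟩ := hqs y
    obtain ⟨a, ha⟩ := exists_sub_algebraMap_mem_maximalIdeal_pow p N r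
    exact ⟨a, ((hq _ _).mpr ha).symm⟩
  · intro y
    obtain ⟨r, rfl⟩ := hqs y
    obtain ⟨G, hG⟩ := exists_sub_aeval_mem_pow hres ht N r
    exact ⟨G, ((hq _ _).mpr hG).symm⟩
  · intro P G hPG i
    have h1 : algebraMap A R P - MvPolynomial.aeval t G ∈ m :=
      Ideal.pow_le_self (Nat.succ_ne_zero _) ((hq _ _).mp hPG)
    have h2 : algebraMap ℂ R (z P - originPoint d G) ∈ m := by
      have h3 := sub_mem (add_mem h1 (horigin G)) (hzm P)
      rw [map_sub]
      convert h3 using 1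
      ring
    have h3 : z P = originPoint d G := by
      by_contra hne
      exact algebraMap_notMem_maximalIdeal (sub_ne_zero.mpr hne) h2
    simp [pointChar, h3]
  · intro I hI x P hP
    refine hN₁ N (by omega) I hI x P (algebraMap_mem_maximalIdeal_pow p ?_)
    have h1 : q (algebraMap A R P) = q 0 := by rw [map_zero]; exact hP
    simpa using (hq _ _).mp h1
  · intro I hI x G hG
    refine hN₂ N (by omega) I hI x G (mem_pow_idealOfVars_of_aeval_mem hdim ht ?_)
    have h1 : q (MvPolynomial.aeval t G) = q 0 := by rw [map_zero]; exact hG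
    simpa using (hq _ _).mp h1

/-- The local Weyl module of weight zero does not depend on the algebra. -/
lemma nonempty_weylQuotient_zero_equiv [IsNoetherianRing A] [IsNoetherianRing B] :
    Nonempty ((CurrentEnv A g ⧸ weylIdeal b (0 : b.support → A →ₗ[ℂ] ℂ)) ≃ₗ[ℂ]
      CurrentEnv B g ⧸ weylIdeal b (0 : b.support → B →ₗ[ℂ] ℂ)) := by
  obtain ⟨N₁, hN₁⟩ := exists_pow_annihilates (g := g) (b := b) (0 : b.support → A →ₗ[ℂ] ℂ) ⊤
    (fun _ _ _ => rfl)
  obtain ⟨N₂, hN₂⟩ := exists_pow_annihilates (g := g) (b := b) (0 : b.support → B →ₗ[ℂ] ℂ) ⊤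
    (fun _ _ _ => rfl)
  -- The zero functional vanishes on the unit ideal, so all of g ⊗ A acts by zero and the zero
  -- algebra can serve as the common quotient.
  let π : A →ₐ[ℂ] PUnit.{1} := AlgHom.ofLinearMap 0 rfl fun _ _ => rfl
  let π' : B →ₐ[ℂ] PUnit.{1} := AlgHom.ofLinearMap 0 rfl fun _ _ => rfl
  refine nonempty_weylQuotient_equiv_of_common_quotient π (fun _ => ⟨0, rfl⟩) π' (fun _ => ⟨0, rfl⟩)
    _ _ (fun _ _ _ _ => rfl) (fun I hI x P _ => ?_) (fun I hI x P _ => ?_)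
  · exact hN₁ N₁ le_rfl I hI x P (by rw [Ideal.top_pow]; trivial)
  · exact hN₂ N₂ le_rfl I hI x P (by rw [Ideal.top_pow]; trivial)

end Comparison

/-! ### Assembly over the distinct points. -/

section Main

variable {g : Type*} [LieRing g] [LieAlgebra ℂ g] [FiniteDimensional ℂ g] [IsSemisimple ℂ g]
variable {H : LieSubalgebra ℂ g} [H.IsCartanSubalgebra] (b : (rootSystem H).Base) (d : ℕ)

/-- A complex vector space is isomorphic to a tensor product of local Weyl modules at the origin of
`ℂ^d`. -/
def IsOriginWeylTensor (V : Type*) [AddCommGroup V] [Module ℂ V] : Prop :=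
  ∃ (s : ℕ) (mu : Fin s → DominantWeight b),
    Nonempty (V ≃ₗ[ℂ] ⨂[ℂ] i : Fin s, OriginWeylModule b d (mu i))

variable {b d} {V W : Type*} [AddCommGroup V] [Module ℂ V] [AddCommGroup W] [Module ℂ W]

lemma IsOriginWeylTensor.of_equiv (h : IsOriginWeylTensor b d V) (e : W ≃ₗ[ℂ] V) :
    IsOriginWeylTensor b d W := by
  obtain ⟨s, mu, ⟨f⟩⟩ := h
  exact ⟨s, mu, ⟨e ≪≫ₗ f⟩⟩

lemma isOriginWeylTensor_originWeylModule (mu : DominantWeight b) :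
    IsOriginWeylTensor b d (OriginWeylModule b d mu) :=
  ⟨1, fun _ => mu, ⟨(PiTensorProduct.subsingletonEquiv (R := ℂ)
    (s := fun _ : Fin 1 => OriginWeylModule b d mu) 0).symm⟩⟩

lemma IsOriginWeylTensor.tensor (h : IsOriginWeylTensor b d V) (h' : IsOriginWeylTensor b d W) :
    IsOriginWeylTensor b d (V ⊗[ℂ] W) := by
  obtain ⟨s, mu, ⟨e⟩⟩ := h
  obtain ⟨s', mu', ⟨e'⟩⟩ := h'
  let N : Fin s ⊕ Fin s' → Type _ := fun x => OriginWeylModule b d (Sum.elim mu mu' x)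
  refine ⟨s + s', fun i => Sum.elim mu mu' (finSumFinEquiv.symm i), ⟨?_⟩⟩
  exact TensorProduct.congr e e' ≪≫ₗ PiTensorProduct.tmulEquivDep ℂ N ≪≫ₗ
    PiTensorProduct.reindex ℂ N finSumFinEquiv

lemma isOriginWeylTensor_pointChar_origin (mu : DominantWeight b) :
    IsOriginWeylTensor b d (CurrentEnv (MvPolynomial (Fin d) ℂ) g ⧸
      weylIdeal b (pointChar mu (originPoint d))) := by
  obtain ⟨e⟩ := nonempty_quotient_equiv_of_eq ((localWeylIdeal_eq (g := g) (b := b) (lam := mu)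
    (fun _ _ => originPoint d)).trans (by rw [familyChar_const]))
  exact (isOriginWeylTensor_originWeylModule mu).of_equiv e.symm

variable {A : Type*} [CommRing A] [Algebra ℂ A] [IsNoetherianRing A]

/-- Points are split off one at a time: the kernel of a new point is coprime to the intersection of
the kernels of the others. -/
theorem isOriginWeylTensor_sum (hA : IsNonsingularOfDim A d) (S : Finset (A →ₐ[ℂ] ℂ))
    (n : (A →ₐ[ℂ] ℂ) → DominantWeight b) :
    IsOriginWeylTensor b d (CurrentEnv A g ⧸ weylIdeal b (∑ z ∈ S, pointChar (n z) z)) := by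
  classical
  induction S using Finset.induction_on with
  -- The empty sum is matched with a single factor of weight zero at the origin, so this module need
  -- not be computed.
  | empty =>
    obtain ⟨e⟩ := nonempty_weylQuotient_zero_equiv (A := A) (B := MvPolynomial (Fin d) ℂ) (b := b)
    have h0 : pointChar (0 : DominantWeight b) (originPoint d) = 0 := by
      funext i
      simp [pointChar]
    have h := isOriginWeylTensor_pointChar_origin (d := d) (0 : DominantWeight b)
    rw [h0] at h
    rw [Finset.sum_empty]
    exact h.of_equiv e
  | insert z S hz ih =>
    have hint : ∀ z i, ∃ k : ℤ, pointChar (n z) z i 1 = k := fun z i => ⟨n z i, by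
      simp [pointChar]⟩
    obtain ⟨e⟩ := nonempty_weylQuotient_add_equiv (g := g) (pointChar (n z) z)
      (∑ w ∈ S, pointChar (n w) w) (RingHom.ker z) (⨅ w ∈ S, RingHom.ker w)
      (Ideal.sup_iInf_eq_top fun w hw => ker_sup_ker_eq_top (by rintro rfl; exact hz hw))
      (fun P hP i => by
        have : z P = 0 := hP
        simp [pointChar, this])
      (fun P hP i => by
        rw [Finset.sum_apply, LinearMap.sum_apply]
        refine Finset.sum_eq_zero fun w hw => ?_
        have : w P = 0 := by
          simp only [Submodule.mem_iInf] at hP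
          exact hP w hw
        simp [pointChar, this])
      (hint z)
      (fun i => by
        rw [Finset.sum_apply, LinearMap.sum_apply]
        choose k hk using fun w => hint w i
        exact ⟨∑ w ∈ S, k w, by rw [Int.cast_sum]; exact Finset.sum_congr rfl fun w _ => hk w⟩)
    obtain ⟨e'⟩ := nonempty_pointWeyl_equiv (g := g) hA (n z) z
    rw [Finset.sum_insert hz]
    exact (((isOriginWeylTensor_pointChar_origin (n z)).of_equiv e').tensor ih).of_equiv e

end Main

end WeylModule

end
theorem mainTheorem11 {g : Type*} [LieRing g] [LieAlgebra ℂ g] [FiniteDimensional ℂ g]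
    [LieAlgebra.IsSemisimple ℂ g] (H : LieSubalgebra ℂ g) [H.IsCartanSubalgebra]
    (b : (LieAlgebra.IsKilling.rootSystem H).Base)
    {A : Type*} [CommRing A] [Algebra ℂ A] [Algebra.FiniteType ℂ A]
    (d : ℕ) (hA : WeylModule.IsNonsingularOfDim A d)
    (lam : WeylModule.DominantWeight b) (Z : WeylModule.PointFamily A lam) :
    ∃ (s : ℕ) (mu : Fin s → WeylModule.DominantWeight b),
      Nonempty (WeylModule.LocalWeylModule b Z ≃ₗ[ℂ]
        ⨂[ℂ] i : Fin s, WeylModule.OriginWeylModule b d (mu i)) := by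
  have : IsNoetherianRing A := Algebra.FiniteType.isNoetherianRing ℂ A
  obtain ⟨S, n, hS⟩ := WeylModule.exists_familyChar_eq_sum Z
  have h := WeylModule.isOriginWeylTensor_sum hA S n
  rw [← hS, ← WeylModule.localWeylIdeal_eq] at h
  exact h
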